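/- **Setting.** $P$ is a finite set of $n$ pages and $1\le k<n$ is the number of cache slots. Each page $p$ has a distribution $\mathcal D_p$ supported in $(0,1]$, with mean $w_p$ (its weight). The input $Q$ is a sequence of $T$ requests from $P$. Evicting $p$ costs $w_p$. Fix the outcomes $x_{p,1},x_{p,2},\dots\in(0,1]$ of the samples of the pages. **Fractional algorithm $\mathrm{ONF}$.** It keeps anti-servers $y_p\in[0,1]$ (initially $1$), total evicted fractions $m_p$ (initially $0$), numbers of samples $n_p$ (initially $0$) and confidence bounds $\mathrm{LCB}_p,\mathrm{UCB}_p$ (initially $0,1$). On a request of $p_t$ it sets $y_{p_t}:=0$. Then, while $\sum_p y_p<n-k$, it continuously increases every $y_p<1$, $p\ne p_t$, at rate $(y_p+\frac1k)/\mathrm{LCB}_p$, and $m_p$ with it. Whenever $m_p$ reaches $n_p\ge 1$, it demands a sample of $p$. The first sample of $p$ is demanded at the end of the first request of $p$. On receiving the $i$-th sample of $p$, let $\bar w$ be the mean of the $i$ samples and $r=\sqrt{\log(4n^3T^3)/(2i)}$. If $i=1$, then $\mathrm{LCB}_p:=\bar w/(2n^2T)$ and $\mathrm{UCB}_p:=1$.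 If $i>1$, then $\mathrm{LCB}_p:=\max\{\mathrm{LCB}_p,\bar w-r\}$ and $\mathrm{UCB}_p:=\min\{\mathrm{UCB}_p,\bar w+r\}$. Let $\overline{\mathrm{ONF}}(Q)$ be its cost when evicting an $\varepsilon$ fraction of $p$ costs $\varepsilon\cdot\mathrm{UCB}_p$ (current value). The good event is that $\mathrm{LCB}_p\le w_p\le\mathrm{UCB}_p$ for all $p$ at all times. **Distributions.** The class of $p$ is the integer $i$ with $6^i\le\mathrm{UCB}_p<6^{i+1}$. $P_i$ and $P_{\ge i}$ are the sets of pages of class $i$ and of class at least $i$, and $Y_i=\sum_{p\in P_{\ge i}}y_p$. A distribution $\mu$ over anti-caches (sets $S\subseteq P$ of pages missing from the cache) is *consistent* if $\Pr_{S\sim\mu}[p\in S]=y_p$ for all $p$, and *balanced* if $\lfloor Y_i\rfloor\le|S\cap P_{\ge i}|\le\lceil Y_i\rceil$ for all $i$ and all $S$ in its support. **Rebalancing.** For each class $i$ from the highest to the lowest, repeat the following while some $S$ in the support of $\mu$ violates the balance of class $i$. Choose such an $S$ with $\big||S\cap P_{\ge i}|-Y_i\big|$ maximal. If $|S\cap P_{\ge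 i}|>\lceil Y_i\rceil$, match the whole measure $\mu(S)$ with an equal measure of states $S'$ having $|S'\cap P_{\ge i}|\le\lceil Y_i\rceil-1$, and on the matched measure move a page of $P_i\cap(S\setminus S')$ from $S$ to $S'$. If $|S\cap P_{\ge i}|<\lfloor Y_i\rfloor$, match $\mu(S)$ with states $S'$ having $|S'\cap P_{\ge i}|\ge\lfloor Y_i\rfloor+1$, and move a page of $P_i\cap(S'\setminus S)$ from $S'$ to $S$. **Randomized algorithm $\mathrm{ON}$.** It starts with an empty cache, feeds the requests to an instance of $\mathrm{ONF}$, and stores at most one sample per page. * When $\mathrm{ONF}$ sets $y_{p_t}:=0$, it fetches $p_t$ in all states and rebalances. * It follows the continuous eviction of $\mathrm{ONF}$ along an arbitrary finite subdivision of time. For each piece, one page after the other in any order, if $y_p$ has increased by $\varepsilon>0$, it evicts $p$ on an $\varepsilon$ measure of the states that contain $p$ in the cache, and rebalances. * When $\mathrm{ONF}$ demands a sample of $p$, it hands over (and deletes) the stored one and rebalances for the new bounds. * When $\mathrm{ONF}$ has no pending demand and $\sum_p y_p\ge n-k$, then, if no sample of $p_t$ is stored, it evicts $p_t$, fetches it again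 and stores the sample. If this is the first request of $p_t$, this sample is given to $\mathrm{ONF}$ as its first sample of $p_t$, and another one is taken and stored in the same way. Then the request is completed. **Lemma.** For every input $Q$, all sample outcomes, and all choices that are left open above: 1. At every point between the steps of $\mathrm{ON}$, the distribution of its anti-cache is consistent and balanced with respect to $\mathrm{ONF}$. While $p_t$ is being handled, after its fetch, it is in the cache with probability $1$. Between requests the cache holds at most $k$ pages with probability $1$. Whenever $\mathrm{ONF}$ demands a sample of a page, one is stored. Every partial execution can be continued until all requests are completed. 2. In the good event, the expected total eviction cost of $\mathrm{ON}$ (over the randomness of $\mathrm{ON}$, for the given sample outcomes) satisfies $$\mathbb E[\mathrm{ON}(Q)]\le 62\cdot\overline{\mathrm{ONF}}(Q)+50\,n .$$ -/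

import Mathlib

open MeasureTheory
open scoped ENNReal

noncomputable section

namespace OWP

/-! ### The problem -/

/-- An input of online weighted paging with unknown weights on the page set `P`:
a cache of `k` slots with `1 ≤ k < |P|`, a weight distribution supported in `(0, 1]` for every
page, and the sequence of requests. -/
structure Input (P : Type*) [Fintype P] where
  k : ℕ
  k_pos : 1 ≤ k
  k_lt : k < Fintype.card P
  D : P → Measure ℝ
  isProb : ∀ p, IsProbabilityMeasure (D p)
  support : ∀ p, D p (Set.Ioc (0 : ℝ) 1)ᶜ = 0
  requests : List P

/-- The weight of a page: the mean of its distribution. -/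
def Input.weight {P : Type*} [Fintype P] (I : Input P) (p : P) : ℝ := ∫ v, v ∂(I.D p)

/-! ### The fractional algorithm -/

/-- The state of the fractional algorithm. -/
structure FracState (P : Type*) where
  /-- the anti-server `y p`, the fraction of `p` missing from the cache -/
  y : P → ℝ
  /-- the total fraction of `p` evicted so far -/
  m : P → ℝ
  /-- the number of samples of `p` received so far -/
  cnt : P → ℕ
  /-- the mean of the samples of `p` received so far -/
  wbar : P → ℝ
  /-- the lower confidence bound -/
  lcb : P → ℝ
  /-- the upper confidence bound -/
  ucb : P → ℝ
  /-- the cost so far, where evicting an `ε` fraction of `p` costs `ε` times the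
  upper confidence bound of `p` at that time -/
  cost : ℝ

namespace FracState

/-- Initially the cache is empty and nothing has been sampled. -/
def init (P : Type*) : FracState P where
  y := fun _ => 1
  m := fun _ => 0
  cnt := fun _ => 0
  wbar := fun _ => 0
  lcb := fun _ => 0
  ucb := fun _ => 1
  cost := 0

/-- The requested page is fetched at once. -/
def fetch {P : Type*} [DecidableEq P] (st : FracState P) (p : P) : FracState P :=
  { st with y := Function.update st.y p 0 }

/-- The anti-server after running the continuous eviction for a duration `s` during the request
of `p`: every page `q ≠ p` with `y q < 1` follows `dy/ds = (y + η) / lcb` with `η = 1 / k`, until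
it reaches `1`; nothing else moves. -/
def flowY {P : Type*} [DecidableEq P] (k : ℕ) (st : FracState P) (p : P) (s : ℝ) (q : P) : ℝ :=
  if q ≠ p ∧ st.y q < 1 then
    min 1 ((st.y q + 1 / (k : ℝ)) * Real.exp (s / st.lcb q) - 1 / (k : ℝ))
  else st.y q

theorem flowY_zero {P : Type*} [DecidableEq P] (k : ℕ) (st : FracState P) (p q : P) :
    flowY k st p 0 q = st.y q := by
  unfold flowY
  split_ifs with h
  · have : st.y q ≤ 1 := h.2.le
    simp [this]
  · rfl

/-- As long as a page other than the requested one is not fully evicted, its anti-server grows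
at rate `(y + η) / lcb`. -/
theorem flowY_hasDerivAt {P : Type*} [DecidableEq P] (k : ℕ) (st : FracState P) (p q : P)
    (hq : q ≠ p) (s : ℝ) (hs : flowY k st p s q < 1) :
    HasDerivAt (fun r => flowY k st p r q)
      ((flowY k st p s q + 1 / (k : ℝ)) / st.lcb q) s := by
  by_cases hy : st.y q < 1
  · set g : ℝ → ℝ := fun r =>
      (st.y q + 1 / (k : ℝ)) * Real.exp (r / st.lcb q) - 1 / (k : ℝ) with hg
    have e : ∀ r, flowY k st p r q = min 1 (g r) := fun r => if_pos ⟨hq, hy⟩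
    simp only [e] at hs ⊢
    have hlt : g s < 1 := by
      rcases min_lt_iff.1 hs with h | h
      · exact absurd h (lt_irrefl _)
      · exact h
    have hd : HasDerivAt g ((g s + 1 / (k : ℝ)) / st.lcb q) s := by
      have h1 : HasDerivAt (fun r : ℝ => r / st.lcb q) (1 / st.lcb q) s :=
        (hasDerivAt_id s).div_const _
      have h2 := ((h1.exp).const_mul (st.y q + 1 / (k : ℝ))).sub_const (1 / (k : ℝ))
      have h3 : (g s + 1 / (k : ℝ)) / st.lcb q =
          (st.y q + 1 / (k : ℝ)) * (Real.exp (s / st.lcb q) * (1 / st.lcb q)) := by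
        simp only [hg]
        ring
      rw [h3]
      exact h2
    have hev : (fun r => min 1 (g r)) =ᶠ[nhds s] g := by
      filter_upwards [hd.continuousAt.eventually (gt_mem_nhds hlt)] with r hr
      exact min_eq_right hr.le
    rw [min_eq_right hlt.le]
    exact hd.congr_of_eventuallyEq hev
  · exact absurd hs (by rw [flowY, if_neg (fun h => hy h.2)]; exact hy)

/-- Running the continuous eviction for a duration `s` during the request of `p`. -/
def flow {P : Type*} [Fintype P] [DecidableEq P] (k : ℕ) (st : FracState P) (p : P) (s : ℝ) :
    FracState P :=
  { st with
    y := flowY k st p s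
    m := fun q => st.m q + (flowY k st p s q - st.y q)
    cost := st.cost + ∑ q, st.ucb q * (flowY k st p s q - st.y q) }

/-- Receiving the sample `v` of the page `p` and updating the confidence bounds of `p`;
`n` is the number of pages and `T` the number of requests. -/
def observe {P : Type*} [DecidableEq P] (n T : ℕ) (st : FracState P) (p : P) (v : ℝ) :
    FracState P :=
  let c : ℕ := st.cnt p + 1
  let avg : ℝ := if st.cnt p = 0 then v else (((c : ℝ) - 1) * st.wbar p + v) / c
  let rad : ℝ := Real.sqrt (Real.log (4 * (n : ℝ) ^ 3 * (T : ℝ) ^ 3) / (2 * (c : ℝ)))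
  { st with
    cnt := Function.update st.cnt p c
    wbar := Function.update st.wbar p avg
    lcb := Function.update st.lcb p
      (if st.cnt p = 0 then avg / (2 * (n : ℝ) ^ 2 * (T : ℝ)) else max (st.lcb p) (avg - rad))
    ucb := Function.update st.ucb p
      (if st.cnt p = 0 then 1 else min (st.ucb p) (avg + rad)) }

/-- The total evicted fraction of an already sampled page has reached the next integer,
so that a further sample of it is demanded. -/
def Demands {P : Type*} (st : FracState P) (q : P) : Prop :=
  1 ≤ st.cnt q ∧ st.m q = (st.cnt q : ℝ)

/-- At most `k` pages are fractionally in the cache. -/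
def Feasible {P : Type*} [Fintype P] (k : ℕ) (st : FracState P) : Prop :=
  (Fintype.card P : ℝ) - (k : ℝ) ≤ ∑ q, st.y q

/-- The continuous eviction can run for the duration `s > 0` before a sample is demanded or
feasibility is reached (either may happen exactly at the end of the duration). -/
def CanFlow {P : Type*} [Fintype P] [DecidableEq P] (k : ℕ) (st : FracState P) (p : P) (s : ℝ) :
    Prop :=
  0 < s ∧ (∀ q, ¬ st.Demands q) ∧ ¬ st.Feasible k ∧
    (∀ q, 1 ≤ st.cnt q → (st.flow k p s).m q ≤ (st.cnt q : ℝ)) ∧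
    ∑ q, (st.flow k p s).y q ≤ (Fintype.card P : ℝ) - (k : ℝ)

/-- The class of a page: the integer `i` with `6 ^ i ≤ ucb < 6 ^ (i + 1)`. -/
def cls {P : Type*} (st : FracState P) (p : P) : ℤ := Int.log 6 (st.ucb p)

/-- The confidence bounds are valid for all pages. -/
def BoundsValid {P : Type*} (st : FracState P) (w : P → ℝ) : Prop :=
  ∀ p, st.lcb p ≤ w p ∧ w p ≤ st.ucb p

end FracState

/-! ### Randomized integral states -/

/-- The joint law of the anti-cache (the set of pages missing from the cache) and of the total
eviction cost incurred so far. -/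
abbrev Law (P : Type*) := PMF (Finset P × ℝ≥0∞)

namespace Law

/-- The probability of being in the anti-cache `S`. -/
def mass {P : Type*} (L : Law P) (S : Finset P) : ℝ≥0∞ := (L.map Prod.fst) S

/-- The expectation of the eviction cost incurred so far. -/
def expectedCost {P : Type*} (L : Law P) : ℝ≥0∞ := ∑' a, L a * a.2

/-- The cost of changing the anti-cache from `S` to `T`: the weights of the evicted pages. -/
def evictionCost {P : Type*} [DecidableEq P] (w : P → ℝ) (S T : Finset P) : ℝ≥0∞ :=
  ∑ p ∈ T \ S, ENNReal.ofReal (w p)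

/-- A random move: from the anti-cache `S`, the next anti-cache is drawn from `κ S`. -/
def transition {P : Type*} [DecidableEq P] (w : P → ℝ) (κ : Finset P → PMF (Finset P))
    (L : Law P) : Law P :=
  L.bind fun a => (κ a.1).map fun T => (T, a.2 + evictionCost w a.1 T)

/-- `L'` results from `L` by a random move in which the joint probability of moving from `S` to
`T` is `plan S T`. -/
def Moves {P : Type*} [DecidableEq P] (w : P → ℝ) (L : Law P)
    (plan : Finset P → Finset P → ℝ≥0∞) (L' : Law P) : Prop :=
  ∃ κ : Finset P → PMF (Finset P),
    (∀ S T, L.mass S * κ S T = plan S T) ∧ L' = transition w κ L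

/-- The page `p` is evicted and fetched again at once. -/
def evictAndRefetch {P : Type*} (w : P → ℝ) (p : P) (L : Law P) : Law P :=
  L.map fun a => (a.1, a.2 + ENNReal.ofReal (w p))

/-- The page `p` is fetched, in every state that misses it. -/
def fetch {P : Type*} [DecidableEq P] (w : P → ℝ) (p : P) (L : Law P) : Law P :=
  transition w (fun S => PMF.pure (S.erase p)) L

/-- The page `p` is evicted in some states that contain it, of total probability `ε`:
`ν S` is the part of the probability of `S` where this is done. -/
def Evict {P : Type*} [Fintype P] [DecidableEq P] (w : P → ℝ) (p : P) (ε : ℝ) (L L' : Law P) :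
    Prop :=
  ∃ ν : Finset P → ℝ≥0∞, (∀ S, ν S ≤ L.mass S) ∧ (∀ S, p ∈ S → ν S = 0) ∧
    ∑ S, ν S = ENNReal.ofReal ε ∧
    Moves w L
      (fun S T => (if T = S then L.mass S - ν S else 0) + (if T = insert p S then ν S else 0)) L'

/-- The probability that the page `p` is missing from the cache is `y p`, for every `p`. -/
def Consistent {P : Type*} [Fintype P] [DecidableEq P] (y : P → ℝ) (L : Law P) : Prop :=
  ∀ p, (∑ S, if p ∈ S then L.mass S else 0) = ENNReal.ofReal (y p)

/-- The number of pages of class at least `j` in `S`. -/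
def classCount {P : Type*} (c : P → ℤ) (j : ℤ) (S : Finset P) : ℤ :=
  ((S.filter fun p => j ≤ c p).card : ℤ)

/-- The total anti-server of the pages of class at least `j`. -/
def classTotal {P : Type*} [Fintype P] (c : P → ℤ) (y : P → ℝ) (j : ℤ) : ℝ :=
  ∑ p with j ≤ c p, y p

/-- Class `j` is balanced: every anti-cache that occurs has `⌊Y_j⌋` or `⌈Y_j⌉` pages of class at
least `j`, where `Y_j` is the total anti-server of these pages. -/
def BalancedAt {P : Type*} [Fintype P] (c : P → ℤ) (y : P → ℝ) (j : ℤ) (L : Law P) : Prop :=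
  ∀ S, L.mass S ≠ 0 →
    ⌊classTotal c y j⌋ ≤ classCount c j S ∧ classCount c j S ≤ ⌈classTotal c y j⌉

/-- All classes are balanced. -/
def Balanced {P : Type*} [Fintype P] (c : P → ℤ) (y : P → ℝ) (L : Law P) : Prop :=
  ∀ j, BalancedAt c y j L

/-! ### The rebalancing procedure -/

/-- The whole probability of `S` is matched with the part `mt B` of the probability of the other
states `B`; the part of `S` matched with `B` moves to `out B`, and the matched part of `B` moves
to `inn B`. -/
def swapPlan {P : Type*} [Fintype P] [DecidableEq P] (L : Law P) (S : Finset P)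
    (mt : Finset P → ℝ≥0∞) (out inn : Finset P → Finset P) (A T : Finset P) : ℝ≥0∞ :=
  if A = S then ∑ B, (if T = out B then mt B else 0)
  else (if T = A then L.mass A - mt A else 0) + (if T = inn A then mt A else 0)

/-- One step of rebalancing class `i`. Choose an occurring state `S` whose number of pages of
class at least `i` is farthest from `Y_i` and violates the balance of class `i`. If it has too many
such pages, match its probability with states `B` having at most `⌈Y_i⌉ - 1` of them, and move a
page of class `i` in `S \ B` from the anti-cache `S` to the anti-cache `B`. If it has too few,
do the reverse with states having at least `⌊Y_i⌋ + 1` of them. -/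
def RebalanceMove {P : Type*} [Fintype P] [DecidableEq P] (w : P → ℝ) (c : P → ℤ) (y : P → ℝ)
    (i : ℤ) (L L' : Law P) : Prop :=
  ∃ (S : Finset P) (mt : Finset P → ℝ≥0∞) (pg : Finset P → P),
    L.mass S ≠ 0 ∧
    (∀ B, L.mass B ≠ 0 →
      |(classCount c i B : ℝ) - classTotal c y i| ≤ |(classCount c i S : ℝ) - classTotal c y i|) ∧
    (∀ B, mt B ≤ L.mass B) ∧ ∑ B, mt B = L.mass S ∧
    ((⌈classTotal c y i⌉ + 1 ≤ classCount c i S ∧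
      (∀ B, mt B ≠ 0 → classCount c i B ≤ ⌈classTotal c y i⌉ - 1 ∧
        c (pg B) = i ∧ pg B ∈ S ∧ pg B ∉ B) ∧
      Moves w L (swapPlan L S mt (fun B => S.erase (pg B)) (fun B => insert (pg B) B)) L') ∨
     (classCount c i S ≤ ⌊classTotal c y i⌋ - 1 ∧
      (∀ B, mt B ≠ 0 → ⌊classTotal c y i⌋ + 1 ≤ classCount c i B ∧
        c (pg B) = i ∧ pg B ∈ B ∧ pg B ∉ S) ∧
      Moves w L (swapPlan L S mt (fun B => insert (pg B) S) (fun B => B.erase (pg B))) L'))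

/-- Rebalancing the listed classes one after the other, each until it is balanced. -/
def RebalanceList {P : Type*} [Fintype P] [DecidableEq P] (w : P → ℝ) (c : P → ℤ) (y : P → ℝ) :
    List ℤ → Law P → Law P → Prop
  | [], L, L' => L' = L
  | i :: l, L, L' => ∃ M : Law P, Relation.ReflTransGen (RebalanceMove w c y i) L M ∧
      BalancedAt c y i M ∧ RebalanceList w c y l M L'

/-- The rebalancing procedure treats the classes from the highest to the lowest. -/
def Rebalance {P : Type*} [Fintype P] [DecidableEq P] (w : P → ℝ) (c : P → ℤ) (y : P → ℝ)
    (L L' : Law P) : Prop :=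
  RebalanceList w c y ((Finset.univ.image c).sort (fun a b => b ≤ a)) L L'

/-- The anti-server of one page `p` rises to its target `z p`: evict `p` with the additional
probability, then rebalance. -/
def EvictPage {P : Type*} [Fintype P] [DecidableEq P] (w : P → ℝ) (c : P → ℤ) (z : P → ℝ)
    (a b : (P → ℝ) × Law P) : Prop :=
  ∃ (p : P) (M : Law P), a.1 p < z p ∧ b.1 = Function.update a.1 p (z p) ∧
    Evict w p (z p - a.1 p) a.2 M ∧ Rebalance w c b.1 M b.2

/-- The rounding follows a change of the anti-servers from `y` to `z`, one page at a time
and in any order. -/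
def FollowEviction {P : Type*} [Fintype P] [DecidableEq P] (w : P → ℝ) (c : P → ℤ) (y z : P → ℝ)
    (L L' : Law P) : Prop :=
  Relation.ReflTransGen (EvictPage w c z) (y, L) (z, L')

end Law

/-! ### The randomized algorithm -/

/-- A configuration of the randomized algorithm. -/
structure Config (P : Type*) where
  /-- the requests that have not arrived yet -/
  todo : List P
  /-- the request being handled, if any -/
  cur : Option P
  /-- the instance of the fractional algorithm -/
  frac : FracState P
  /-- the law of the integral state -/
  law : Law P
  /-- the stored sample of each page, if any -/
  stored : P → Option ℝ
  /-- the number of samples of each page stored so far -/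
  drawn : P → ℕ

/-- Before the first request the cache is empty and no sample is stored. -/
def Config.init {P : Type*} [Fintype P] (I : Input P) : Config P where
  todo := I.requests
  cur := none
  frac := FracState.init P
  law := PMF.pure (Finset.univ, 0)
  stored := fun _ => none
  drawn := fun _ => 0

/-- The steps of the randomized algorithm when the `i`-th sample it stores of page `p`
(counted from `0`) has the value `x p i`. -/
inductive Step {P : Type*} [Fintype P] [DecidableEq P] (I : Input P) (x : P → ℕ → ℝ) :
    Config P → Config P → Prop
  /-- A page is requested; it is fetched fractionally and integrally. -/
  | request (c : Config P) (p : P) (l : List P) (L : Law P)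
      (hcur : c.cur = none) (htodo : c.todo = p :: l)
      (hL : Law.Rebalance I.weight (c.frac.fetch p).cls (c.frac.fetch p).y
        (c.law.fetch I.weight p) L) :
      Step I x c { c with todo := l, cur := some p, frac := c.frac.fetch p, law := L }
  /-- The fractional algorithm runs its continuous eviction for some duration. -/
  | evict (c : Config P) (p : P) (s : ℝ) (L : Law P)
      (hcur : c.cur = some p) (hs : c.frac.CanFlow I.k p s)
      (hL : Law.FollowEviction I.weight c.frac.cls c.frac.y (c.frac.flow I.k p s).y c.law L) :
      Step I x c { c with frac := c.frac.flow I.k p s, law := L }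
  /-- The fractional algorithm demands a sample of `q` and is given the stored one. -/
  | supply (c : Config P) (p q : P) (v : ℝ) (L : Law P)
      (hcur : c.cur = some p) (hq : c.frac.Demands q) (hv : c.stored q = some v)
      (hL : Law.Rebalance I.weight
        (c.frac.observe (Fintype.card P) I.requests.length q v).cls c.frac.y c.law L) :
      Step I x c { c with
        frac := c.frac.observe (Fintype.card P) I.requests.length q v
        law := L
        stored := Function.update c.stored q none }
  /-- The fractional algorithm is done with the request of `p` and no sample of `p` is stored:
  take one by evicting `p` and fetching it again. -/
  | draw (c : Config P) (p : P)
      (hcur : c.cur = some p) (hdem : ∀ q, ¬ c.frac.Demands q) (hfeas : c.frac.Feasible I.k)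
      (hst : c.stored p = none) :
      Step I x c { c with
        law := c.law.evictAndRefetch I.weight p
        stored := Function.update c.stored p (some (x p (c.drawn p)))
        drawn := Function.update c.drawn p (c.drawn p + 1) }
  /-- At the end of the first request of `p` the fractional algorithm demands its first sample
  of `p` and is given the stored one. -/
  | supplyFirst (c : Config P) (p : P) (v : ℝ) (L : Law P)
      (hcur : c.cur = some p) (hdem : ∀ q, ¬ c.frac.Demands q) (hfeas : c.frac.Feasible I.k)
      (hcnt : c.frac.cnt p = 0) (hv : c.stored p = some v)
      (hL : Law.Rebalance I.weight
        (c.frac.observe (Fintype.card P) I.requests.length p v).cls c.frac.y c.law L) :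
      Step I x c { c with
        frac := c.frac.observe (Fintype.card P) I.requests.length p v
        law := L
        stored := Function.update c.stored p none }
  /-- The request of `p` is completed. -/
  | close (c : Config P) (p : P) (v : ℝ)
      (hcur : c.cur = some p) (hdem : ∀ q, ¬ c.frac.Demands q) (hfeas : c.frac.Feasible I.k)
      (hcnt : 1 ≤ c.frac.cnt p) (hv : c.stored p = some v) :
      Step I x c { c with cur := none }

/-- `c` occurs in some execution of the algorithm. -/
def Reachable {P : Type*} [Fintype P] [DecidableEq P] (I : Input P) (x : P → ℕ → ℝ)
    (c : Config P) : Prop :=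
  Relation.ReflTransGen (Step I x) (Config.init I) c

/-- `c` is reached by an execution in the good event: at every time, the confidence bounds of all
pages are valid. -/
def ReachableGood {P : Type*} [Fintype P] [DecidableEq P] (I : Input P) (x : P → ℕ → ℝ)
    (c : Config P) : Prop :=
  (Config.init I).frac.BoundsValid I.weight ∧
    Relation.ReflTransGen (fun a b => Step I x a b ∧ b.frac.BoundsValid I.weight)
      (Config.init I) c

/-- All requests have been handled. -/
def Config.Finished {P : Type*} (c : Config P) : Prop := c.cur = none ∧ c.todo = []

end OWP

end

noncomputable section

set_option linter.unusedSectionVars false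

namespace OWP

namespace Law

/-! ### Masses, expectations and moves -/

/-! Consistency fixes the mean of the number of pages of class at least `j` in the anti-cache to be
`Y_j`. The imbalance `imb` of class `j` is the expected distance of this number from `[⌊Y_j⌋,
⌈Y_j⌉]`, and it vanishes exactly when the class is balanced. Everything is expressed through this
one quantity.

A count that is balanced around its mean `Y` is, in expectation, within `|Y' - Y|` of balance around
`Y'` (`ex_dev_le_abs`). Hence a fetch of `p` creates imbalance at most `2 y_p`, an eviction of
measure `ε` at most `2 ε`, and lowering the class of one page at most `1`, always in classes up to
that of the affected page before the step.

Rebalancing class `i` on measure `a` repairs imbalance at least `a` there, adds at most `2 a` to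
each lower class, leaves higher classes alone and costs at most `6 ^ (i + 1) * a` (`Rebalances`). So
an initial imbalance `d` at most triples from one class to the next, while the weights drop by the
factor `6`; the geometric sum is `12 * 6 ^ i * d` (`RebalanceList.expectedCost_le`). A rebalancing
step exists because deviations from the mean must cancel (`mass_le_sum_of_ex_eq_zero`) and because
the next higher class is already balanced (`exists_page`). The procedure stops because an extremal
state is traded for strictly less extreme ones (`RebalanceMove.potential_lt`).

The cost bound is a potential argument with `Config.credit`. One unit of fractional payment is
multiplied by `62 = 25 + 24 + 13`: `25` for the eviction and its rebalancing, `24` kept for the next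
fetch of the page, and `13` kept for the next sample, of which `12` pay for the change of class and
`1` for replacing the sample. The initial credit is at most `26` per page.

That a demanded sample is always stored rests on the field `unstored` of `Invariant`: without a
stored sample, a page that is not being requested cannot accumulate enough evicted fraction to cause
a demand. -/

/-- The probability of the anti-cache `S` as a real number. -/
def pr {P : Type*} (L : Law P) (S : Finset P) : ℝ := (L.mass S).toReal

/-- The expectation of a function of the anti-cache. -/
def ex {P : Type*} [Fintype P] (L : Law P) (f : Finset P → ℝ) : ℝ := ∑ S, L.pr S * f S

theorem mass_ne_top {P : Type*} (L : Law P) (S : Finset P) : L.mass S ≠ ⊤ :=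
  PMF.apply_ne_top _ _

theorem pr_nonneg {P : Type*} (L : Law P) (S : Finset P) : 0 ≤ L.pr S := ENNReal.toReal_nonneg

theorem ofReal_pr {P : Type*} (L : Law P) (S : Finset P) : ENNReal.ofReal (L.pr S) = L.mass S :=
  ENNReal.ofReal_toReal (L.mass_ne_top S)

theorem pr_ne_zero_iff {P : Type*} (L : Law P) (S : Finset P) : L.pr S ≠ 0 ↔ L.mass S ≠ 0 := by
  simp [pr, ENNReal.toReal_eq_zero_iff, L.mass_ne_top S]

theorem sum_mass {P : Type*} [Fintype P] (L : Law P) : ∑ S, L.mass S = 1 := by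
  have := (L.map Prod.fst).tsum_coe
  rwa [tsum_fintype] at this

theorem sum_pr {P : Type*} [Fintype P] (L : Law P) : ∑ S, L.pr S = 1 := by
  unfold pr
  rw [← ENNReal.toReal_sum fun S _ => L.mass_ne_top S, sum_mass, ENNReal.toReal_one]

theorem ex_mono {P : Type*} [Fintype P] (L : Law P) {f g : Finset P → ℝ}
    (h : ∀ S, L.mass S ≠ 0 → f S ≤ g S) : L.ex f ≤ L.ex g := by
  refine Finset.sum_le_sum fun S _ => ?_
  by_cases hS : L.mass S = 0
  · simp [pr, hS]
  · exact mul_le_mul_of_nonneg_left (h S hS) (L.pr_nonneg S)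

theorem ex_congr {P : Type*} [Fintype P] (L : Law P) {f g : Finset P → ℝ}
    (h : ∀ S, L.mass S ≠ 0 → f S = g S) : L.ex f = L.ex g :=
  le_antisymm (L.ex_mono fun S hS => (h S hS).le) (L.ex_mono fun S hS => (h S hS).ge)

theorem ex_add {P : Type*} [Fintype P] (L : Law P) (f g : Finset P → ℝ) :
    L.ex (fun S => f S + g S) = L.ex f + L.ex g := by
  simp [ex, mul_add, Finset.sum_add_distrib]

theorem ex_sub {P : Type*} [Fintype P] (L : Law P) (f g : Finset P → ℝ) :
    L.ex (fun S => f S - g S) = L.ex f - L.ex g := by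
  simp [ex, mul_sub, Finset.sum_sub_distrib]

theorem ex_const {P : Type*} [Fintype P] (L : Law P) (r : ℝ) : L.ex (fun _ => r) = r := by
  simp [ex, ← Finset.sum_mul, sum_pr]

theorem ex_finset_sum {P ι : Type*} [Fintype P] (L : Law P) (s : Finset ι)
    (f : ι → Finset P → ℝ) : L.ex (fun S => ∑ i ∈ s, f i S) = ∑ i ∈ s, L.ex (f i) := by
  simp only [ex, Finset.mul_sum]
  rw [Finset.sum_comm]

theorem tsum_map_mul {α β : Type*} (q : PMF α) (f : α → β) (g : β → ℝ≥0∞) :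
    ∑' b, (q.map f) b * g b = ∑' a, q a * g (f a) := by
  simp only [PMF.map_apply, ← ENNReal.tsum_mul_right]
  rw [ENNReal.tsum_comm]
  refine tsum_congr fun a => ?_
  rw [tsum_eq_single (f a)]
  · simp
  · intro b hb
    simp [hb]

theorem tsum_bind_mul {α β : Type*} (q : PMF α) (f : α → PMF β) (g : β → ℝ≥0∞) :
    ∑' b, (q.bind f) b * g b = ∑' a, q a * ∑' b, f a b * g b := by
  simp only [PMF.bind_apply, ← ENNReal.tsum_mul_right, ← ENNReal.tsum_mul_left]
  rw [ENNReal.tsum_comm]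
  simp only [mul_assoc]

theorem tsum_mul_fst {P : Type*} [Fintype P] (L : Law P) (g : Finset P → ℝ≥0∞) :
    ∑' a, L a * g a.1 = ∑ S, L.mass S * g S := by
  rw [← tsum_fintype (L := .unconditional _)]
  exact (tsum_map_mul L Prod.fst g).symm

variable {P : Type*} [Fintype P] [DecidableEq P] {w : P → ℝ} {L L' : Law P}
  {plan : Finset P → Finset P → ℝ≥0∞}

theorem mass_transition (κ : Finset P → PMF (Finset P)) (T : Finset P) :
    (transition w κ L).mass T = ∑ S, L.mass S * κ S T := by
  rw [← tsum_mul_fst]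
  simp only [mass, transition, PMF.map_bind, PMF.map_comp, PMF.bind_apply]
  refine tsum_congr fun a => ?_
  congr 1
  have : (Prod.fst ∘ fun T => (T, a.2 + evictionCost w a.1 T)) = id := rfl
  rw [this, PMF.map_id]

theorem expectedCost_transition (κ : Finset P → PMF (Finset P)) :
    (transition w κ L).expectedCost =
      L.expectedCost + ∑ S, ∑ T, L.mass S * κ S T * evictionCost w S T := by
  simp only [mul_assoc, ← Finset.mul_sum]
  rw [← tsum_mul_fst]
  unfold expectedCost
  rw [← ENNReal.tsum_add, transition, tsum_bind_mul]
  refine tsum_congr fun a => ?_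
  rw [tsum_map_mul, ← mul_add]
  congr 1
  simp only [mul_add]
  rw [ENNReal.tsum_add, ENNReal.tsum_mul_right, PMF.tsum_coe, one_mul, tsum_fintype]

theorem Moves.mass_eq (h : Moves w L plan L') (T : Finset P) :
    L'.mass T = ∑ S, plan S T := by
  obtain ⟨κ, hκ, rfl⟩ := h
  simp [mass_transition, hκ]

theorem Moves.expectedCost_eq (h : Moves w L plan L') :
    L'.expectedCost = L.expectedCost + ∑ S, ∑ T, plan S T * evictionCost w S T := by
  obtain ⟨κ, hκ, rfl⟩ := h
  simp [expectedCost_transition, hκ]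

theorem Moves.plan_ne_top (h : Moves w L plan L') (S T : Finset P) : plan S T ≠ ⊤ := by
  obtain ⟨κ, hκ, rfl⟩ := h
  rw [← hκ]
  exact ENNReal.mul_ne_top (L.mass_ne_top S) (PMF.apply_ne_top _ _)

theorem Moves.ex_eq (h : Moves w L plan L') (f : Finset P → ℝ) :
    L'.ex f = ∑ S, ∑ T, (plan S T).toReal * f T := by
  rw [Finset.sum_comm]
  refine Finset.sum_congr rfl fun T _ => ?_
  rw [← Finset.sum_mul, pr, h.mass_eq, ENNReal.toReal_sum fun S _ => h.plan_ne_top S T]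

theorem Moves.exists_of_mass_ne_zero (h : Moves w L plan L') {T : Finset P}
    (hT : L'.mass T ≠ 0) : ∃ S, plan S T ≠ 0 := by
  rw [h.mass_eq] at hT
  obtain ⟨S, -, hS⟩ := Finset.exists_ne_zero_of_sum_ne_zero hT
  exact ⟨S, hS⟩

/-- The kernel is the plan normalised by the mass of the starting state. At states of mass zero the
row of the plan vanishes and any kernel serves. -/
theorem exists_moves (w : P → ℝ) (hrow : ∀ S, ∑ T, plan S T = L.mass S) :
    ∃ L', Moves w L plan L' := by
  classical
  have key : ∀ S, ∃ q : PMF (Finset P), ∀ T, L.mass S * q T = plan S T := by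
    intro S
    by_cases hS : L.mass S = 0
    · refine ⟨PMF.pure S, fun T => ?_⟩
      have h0 := hrow S
      rw [hS, Finset.sum_eq_zero_iff] at h0
      rw [hS, zero_mul, h0 T (Finset.mem_univ _)]
    · refine ⟨PMF.ofFintype (fun T => plan S T / L.mass S) ?_, fun T => ?_⟩
      · simp only [div_eq_mul_inv]
        rw [← Finset.sum_mul, hrow, ENNReal.mul_inv_cancel hS (L.mass_ne_top S)]
      · rw [PMF.ofFintype_apply, ENNReal.mul_div_cancel hS (L.mass_ne_top S)]
  choose κ hκ using key
  exact ⟨_, κ, hκ, rfl⟩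

/-! ### Consistency in terms of expectations -/

theorem Consistent.ex_mem {y : P → ℝ} (h : L.Consistent y) {p : P} (hy : 0 ≤ y p) :
    L.ex (fun S => if p ∈ S then 1 else 0) = y p := by
  have h1 := congrArg ENNReal.toReal (h p)
  rw [ENNReal.toReal_ofReal hy, ENNReal.toReal_sum] at h1
  · rw [← h1]
    refine Finset.sum_congr rfl fun S _ => ?_
    split_ifs with hp <;> simp [pr, hp]
  · intro S _
    split_ifs
    exacts [L.mass_ne_top S, ENNReal.zero_ne_top]

theorem consistent_of_ex {y : P → ℝ}
    (h : ∀ p, L.ex (fun S => if p ∈ S then 1 else 0) = y p) : L.Consistent y := by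
  intro p
  rw [← h p, ex, ENNReal.ofReal_sum_of_nonneg]
  · refine Finset.sum_congr rfl fun S _ => ?_
    split_ifs <;> simp [ofReal_pr]
  · intro S _
    have := L.pr_nonneg S
    split_ifs <;> simp [this]

theorem Consistent.congr_ex {y : P → ℝ} (h : L.Consistent y) (hy : ∀ p, 0 ≤ y p)
    (hex : ∀ p, L'.ex (fun S => if p ∈ S then 1 else 0) =
      L.ex (fun S => if p ∈ S then 1 else 0)) : L'.Consistent y :=
  consistent_of_ex fun p => (hex p).trans (h.ex_mem (hy p))

theorem classCount_eq_sum (c : P → ℤ) (j : ℤ) (S : Finset P) :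
    (classCount c j S : ℝ) = ∑ p with j ≤ c p, if p ∈ S then (1 : ℝ) else 0 := by
  rw [Finset.sum_boole, classCount, Int.cast_natCast]
  congr 2
  ext p
  simp [and_comm]

theorem Consistent.ex_classCount {y : P → ℝ} (h : L.Consistent y) (hy : ∀ p, 0 ≤ y p)
    (c : P → ℤ) (j : ℤ) : L.ex (fun S => (classCount c j S : ℝ)) = classTotal c y j := by
  simp only [classCount_eq_sum]
  rw [ex_finset_sum]
  exact Finset.sum_congr rfl fun p _ => h.ex_mem (hy p)

theorem Consistent.notMem {y : P → ℝ} (h : L.Consistent y) {p : P} (hy : y p = 0)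
    {S : Finset P} (hS : L.mass S ≠ 0) : p ∉ S := by
  intro hp
  have h1 := h p
  rw [hy, ENNReal.ofReal_zero, Finset.sum_eq_zero_iff] at h1
  have h2 := h1 S (Finset.mem_univ _)
  rw [if_pos hp] at h2
  exact hS h2

/-! ### Fetching and evicting -/

theorem fetch_moves (w : P → ℝ) (p : P) (L : Law P) :
    Moves w L (fun S T => L.mass S * PMF.pure (S.erase p) T) (fetch w p L) :=
  ⟨_, fun _ _ => rfl, rfl⟩

theorem ex_fetch (w : P → ℝ) (p : P) (L : Law P) (f : Finset P → ℝ) :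
    (fetch w p L).ex f = L.ex fun S => f (S.erase p) := by
  rw [(fetch_moves w p L).ex_eq]
  refine Finset.sum_congr rfl fun S _ => ?_
  rw [Finset.sum_eq_single (S.erase p)]
  · simp [pr]
  · intro T _ hT
    simp [PMF.pure_apply, hT]
  · simp

theorem expectedCost_fetch (w : P → ℝ) (p : P) (L : Law P) :
    (fetch w p L).expectedCost = L.expectedCost := by
  rw [(fetch_moves w p L).expectedCost_eq]
  convert add_zero _
  refine Finset.sum_eq_zero fun S _ => Finset.sum_eq_zero fun T _ => ?_
  by_cases hT : T = S.erase p
  · subst hT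
    have : S.erase p \ S = ∅ := Finset.sdiff_eq_empty_iff_subset.2 (Finset.erase_subset _ _)
    simp [evictionCost, this]
  · simp [PMF.pure_apply, hT]

theorem mass_evictAndRefetch (w : P → ℝ) (p : P) (L : Law P) (S : Finset P) :
    (evictAndRefetch w p L).mass S = L.mass S := by
  simp only [mass, evictAndRefetch, PMF.map_comp]
  rfl

theorem expectedCost_evictAndRefetch (w : P → ℝ) (p : P) (L : Law P) :
    (evictAndRefetch w p L).expectedCost = L.expectedCost + ENNReal.ofReal (w p) := by
  unfold expectedCost evictAndRefetch
  rw [tsum_map_mul]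
  simp only [mul_add]
  rw [ENNReal.tsum_add, ENNReal.tsum_mul_right, PMF.tsum_coe, one_mul]

end Law

theorem sum_sub_sum_of_eq_off {α : Type*} [Fintype α] [DecidableEq α] {f g : α → ℝ} (a : α)
    (h : ∀ b, b ≠ a → f b = g b) : ∑ b, f b - ∑ b, g b = f a - g a := by
  rw [← Finset.sum_sub_distrib, Finset.sum_eq_single a]
  · intro b _ hb
    rw [h b hb, sub_self]
  · simp

namespace Law

variable {P : Type*} [Fintype P] [DecidableEq P] {w : P → ℝ} {L L' : Law P}

theorem evictionCost_self (w : P → ℝ) (S : Finset P) : evictionCost w S S = 0 := by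
  simp [evictionCost]

theorem evictionCost_erase (w : P → ℝ) (p : P) (S : Finset P) :
    evictionCost w S (S.erase p) = 0 := by
  have : S.erase p \ S = ∅ := Finset.sdiff_eq_empty_iff_subset.2 (Finset.erase_subset _ _)
  simp [evictionCost, this]

theorem evictionCost_insert_le (w : P → ℝ) (p : P) (S : Finset P) :
    evictionCost w S (insert p S) ≤ ENNReal.ofReal (w p) := by
  have : insert p S \ S ⊆ {p} := by
    intro q hq
    simp only [Finset.mem_sdiff, Finset.mem_insert] at hq
    simp only [Finset.mem_singleton]
    tauto
  calc evictionCost w S (insert p S) ≤ ∑ q ∈ {p}, ENNReal.ofReal (w q) :=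
        Finset.sum_le_sum_of_subset this
    _ = _ := by simp

/-! ### Evicting a page on part of the probability space -/

theorem evictPlan_row_sum {ν : Finset P → ℝ≥0∞} {p : P} (hν : ∀ S, ν S ≤ L.mass S)
    (S : Finset P) :
    ∑ T, ((if T = S then L.mass S - ν S else 0) + (if T = insert p S then ν S else 0)) =
      L.mass S := by
  rw [Finset.sum_add_distrib]
  simp [tsub_add_cancel_of_le (hν S)]

/-- Passes to real numbers, where the truncated subtraction in the plan becomes an ordinary one and
expectations change by an explicit sum. -/
theorem Evict.exists_shift {p : P} {ε : ℝ} (hε : 0 ≤ ε) (h : Evict w p ε L L') :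
    ∃ ν : Finset P → ℝ, (∀ S, 0 ≤ ν S) ∧ (∀ S, p ∈ S → ν S = 0) ∧ ∑ S, ν S = ε ∧
      (∀ f, L'.ex f = L.ex f + ∑ S, ν S * (f (insert p S) - f S)) ∧
      L'.expectedCost ≤ L.expectedCost + ENNReal.ofReal ε * ENNReal.ofReal (w p) := by
  obtain ⟨ν, hν, hp, hsum, hm⟩ := h
  have hfin : ∀ S, ν S ≠ ⊤ := fun S => ne_top_of_le_ne_top (L.mass_ne_top S) (hν S)
  refine ⟨fun S => (ν S).toReal, fun S => ENNReal.toReal_nonneg, fun S hS => by simp [hp S hS],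
    ?_, fun f => ?_, ?_⟩
  · rw [← ENNReal.toReal_sum fun S _ => hfin S, hsum, ENNReal.toReal_ofReal hε]
  · rw [hm.ex_eq, ex, ← Finset.sum_add_distrib]
    refine Finset.sum_congr rfl fun S _ => ?_
    have : ∀ T, ((if T = S then L.mass S - ν S else 0) +
        (if T = insert p S then ν S else 0)).toReal * f T =
        (if T = S then (L.pr S - (ν S).toReal) * f S else 0) +
        (if T = insert p S then (ν S).toReal * f (insert p S) else 0) := by
      intro T
      rw [ENNReal.toReal_add, add_mul]
      · congr 1
        · split_ifs with h
          · rw [ENNReal.toReal_sub_of_le (hν S) (L.mass_ne_top S), h, pr]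
          · simp
        · split_ifs with h
          · rw [h]
          · simp
      · split_ifs
        exacts [ENNReal.sub_ne_top (L.mass_ne_top S), ENNReal.zero_ne_top]
      · split_ifs
        exacts [hfin S, ENNReal.zero_ne_top]
    simp only [this, Finset.sum_add_distrib, Finset.sum_ite_eq', Finset.mem_univ, if_true]
    ring
  · rw [hm.expectedCost_eq, ← hsum, Finset.sum_mul]
    gcongr with S _
    simp only [add_mul, ite_mul, zero_mul, Finset.sum_add_distrib, Finset.sum_ite_eq',
      Finset.mem_univ, if_true, evictionCost_self, mul_zero, zero_add]
    gcongr
    exact evictionCost_insert_le w p S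

/-- Takes the same proportion `m / t` of every state of `s`, where `t` is the total mass of `s`. -/
theorem exists_part {s : Finset (Finset P)} {m : ℝ≥0∞} (hm : m ≤ ∑ S ∈ s, L.mass S) :
    ∃ ν : Finset P → ℝ≥0∞, (∀ S, ν S ≤ L.mass S) ∧ (∀ S, S ∉ s → ν S = 0) ∧ ∑ S, ν S = m := by
  set t := ∑ S ∈ s, L.mass S with ht
  have htop : t ≠ ⊤ := ENNReal.sum_ne_top.2 fun S _ => L.mass_ne_top S
  by_cases h0 : t = 0
  · refine ⟨fun _ => 0, fun _ => zero_le, fun _ _ => rfl, ?_⟩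
    rw [h0] at hm
    simp [nonpos_iff_eq_zero.1 hm]
  · refine ⟨fun S => if S ∈ s then L.mass S * (m / t) else 0, fun S => ?_, fun S hS => by simp [hS],
      ?_⟩
    · dsimp only
      split_ifs
      · calc L.mass S * (m / t) ≤ L.mass S * 1 := by
              gcongr
              exact ENNReal.div_le_of_le_mul (by rwa [one_mul])
          _ = _ := mul_one _
      · exact zero_le
    · rw [Finset.sum_ite_mem, Finset.univ_inter, ← Finset.sum_mul, ← ht,
        ENNReal.mul_div_cancel h0 htop]

/-- By consistency the states that hold `p` in the cache have total mass `1 - y p`, which is at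
least `ε`. -/
theorem exists_evict (w : P → ℝ) {y : P → ℝ} (h : L.Consistent y) {p : P} {ε : ℝ}
    (hy : 0 ≤ y p) (hε : y p + ε ≤ 1) : ∃ L', Evict w p ε L L' := by
  have h1 : ENNReal.ofReal ε ≤ ∑ S with p ∉ S, L.mass S := by
    have h2 := L.sum_mass
    rw [← Finset.sum_filter_add_sum_filter_not Finset.univ (fun S => p ∈ S), Finset.sum_filter,
      h p] at h2
    have h3 : ENNReal.ofReal (y p) + ENNReal.ofReal ε ≤
        ENNReal.ofReal (y p) + ∑ S with p ∉ S, L.mass S := by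
      rw [h2]
      rcases le_total 0 ε with h0 | h0
      · rw [← ENNReal.ofReal_add hy h0, ← ENNReal.ofReal_one]
        exact ENNReal.ofReal_le_ofReal hε
      · rw [ENNReal.ofReal_of_nonpos h0, add_zero, ← h2]
        exact le_self_add
    exact (ENNReal.add_le_add_iff_left ENNReal.ofReal_ne_top).1 h3
  obtain ⟨ν, hν, hν0, hsum⟩ := exists_part h1
  obtain ⟨L', hL'⟩ := exists_moves w fun S => evictPlan_row_sum (p := p) hν S
  exact ⟨L', ν, hν, fun S hS => hν0 S (by simp [hS]), hsum, hL'⟩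

/-! ### Swaps -/

variable {S : Finset P} {mt : Finset P → ℝ≥0∞} {out inn : Finset P → Finset P}

theorem swapPlan_row_sum (hmt : ∀ B, mt B ≤ L.mass B) (hsum : ∑ B, mt B = L.mass S)
    (A : Finset P) : ∑ T, swapPlan L S mt out inn A T = L.mass A := by
  unfold swapPlan
  split_ifs with h
  · rw [Finset.sum_comm, h, ← hsum]
    simp
  · rw [Finset.sum_add_distrib]
    simp [tsub_add_cancel_of_le (hmt A)]

/-- The hypothesis `mt S = 0` says that `S` is not its own partner. Then the row of `S` is replaced
entirely, and every other row changes only on its matched part. -/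
theorem Moves.ex_swap (h : Moves w L (swapPlan L S mt out inn) L') (hmt : ∀ B, mt B ≤ L.mass B)
    (hsum : ∑ B, mt B = L.mass S) (hS : mt S = 0) (f : Finset P → ℝ) :
    L'.ex f = L.ex f + ∑ B, (mt B).toReal * (f (out B) - f S + (f (inn B) - f B)) := by
  have hfin : ∀ S, mt S ≠ ⊤ := fun S => ne_top_of_le_ne_top (L.mass_ne_top S) (hmt S)
  have hpr : L.pr S = ∑ B, (mt B).toReal := by
    rw [pr, ← hsum, ENNReal.toReal_sum fun S _ => hfin S]
  have hrow : ∀ A, A ≠ S → ∑ T, (swapPlan L S mt out inn A T).toReal * f T =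
      L.pr A * f A + (mt A).toReal * (f (inn A) - f A) := by
    intro A hA
    have : ∀ T, (swapPlan L S mt out inn A T).toReal * f T =
        (if T = A then (L.pr A - (mt A).toReal) * f A else 0) +
        (if T = inn A then (mt A).toReal * f (inn A) else 0) := by
      intro T
      rw [swapPlan, if_neg hA, ENNReal.toReal_add, add_mul]
      · congr 1
        · split_ifs with h
          · rw [ENNReal.toReal_sub_of_le (hmt A) (L.mass_ne_top A), h, pr]
          · simp
        · split_ifs with h
          · rw [h]
          · simp
      · split_ifs
        exacts [ENNReal.sub_ne_top (L.mass_ne_top A), ENNReal.zero_ne_top]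
      · split_ifs
        exacts [hfin A, ENNReal.zero_ne_top]
    simp only [this, Finset.sum_add_distrib, Finset.sum_ite_eq', Finset.mem_univ, if_true]
    ring
  have hrowS : ∑ T, (swapPlan L S mt out inn S T).toReal * f T =
      ∑ B, (mt B).toReal * f (out B) := by
    have : ∀ T, (swapPlan L S mt out inn S T).toReal * f T =
        ∑ B, if T = out B then (mt B).toReal * f (out B) else 0 := by
      intro T
      rw [swapPlan, if_pos rfl, ENNReal.toReal_sum, Finset.sum_mul]
      · refine Finset.sum_congr rfl fun B _ => ?_
        split_ifs with h
        · rw [h]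
        · simp
      · intro B _
        split_ifs
        exacts [hfin B, ENNReal.zero_ne_top]
    simp only [this]
    rw [Finset.sum_comm]
    simp
  have key := sum_sub_sum_of_eq_off S hrow
  rw [← h.ex_eq, hrowS, hS, hpr, Finset.sum_add_distrib, Finset.sum_mul] at key
  simp only [mul_add, Finset.sum_add_distrib]
  simp only [mul_sub, Finset.sum_sub_distrib, ENNReal.toReal_zero, zero_mul] at key ⊢
  unfold ex at key ⊢
  linarith

theorem Moves.expectedCost_swap_le (h : Moves w L (swapPlan L S mt out inn) L') :
    L'.expectedCost ≤ L.expectedCost +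
      ∑ B, mt B * (evictionCost w S (out B) + evictionCost w B (inn B)) := by
  rw [h.expectedCost_eq]
  refine add_le_add le_rfl ?_
  have hrow : ∀ A, ∑ T, swapPlan L S mt out inn A T * evictionCost w A T ≤
      (if A = S then ∑ B, mt B * evictionCost w S (out B) else 0) +
        mt A * evictionCost w A (inn A) := by
    intro A
    by_cases hA : A = S
    · subst hA
      simp only [swapPlan, if_true, Finset.sum_mul, ite_mul, zero_mul]
      rw [Finset.sum_comm]
      simp
    · simp [swapPlan, hA, add_mul, Finset.sum_add_distrib, ite_mul, evictionCost_self]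
  calc _ ≤ _ := Finset.sum_le_sum fun A _ => hrow A
    _ = _ := by
      rw [Finset.sum_add_distrib, Finset.sum_ite_eq', if_pos (Finset.mem_univ _)]
      simp only [mul_add, Finset.sum_add_distrib]

theorem Moves.swap_support (h : Moves w L (swapPlan L S mt out inn) L') {T : Finset P}
    (hT : L'.mass T ≠ 0) (hmt : ∀ B, mt B ≤ L.mass B) :
    (L.mass T ≠ 0 ∧ T ≠ S) ∨ ∃ B, mt B ≠ 0 ∧ (T = out B ∨ T = inn B) := by
  obtain ⟨A, hA⟩ := h.exists_of_mass_ne_zero hT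
  unfold swapPlan at hA
  split_ifs at hA with h1 h2 h3 h3
  · obtain ⟨B, -, hB⟩ := Finset.exists_ne_zero_of_sum_ne_zero hA
    refine Or.inr ⟨B, ?_, Or.inl ?_⟩
    · rintro h0
      simp [h0] at hB
    · by_contra h0
      simp [h0] at hB
  · refine Or.inl ⟨?_, h2 ▸ h1⟩
    rw [h2]
    rintro h0
    have := hmt A
    rw [h0] at this hA
    simp [nonpos_iff_eq_zero.1 this] at hA
  · refine Or.inl ⟨?_, h2 ▸ h1⟩
    rw [h2]
    rintro h0
    simp [h0] at hA
  · exact Or.inr ⟨A, by simpa using hA, Or.inr h3⟩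
  · simp at hA

end Law

namespace Law

variable {P : Type*} [Fintype P] [DecidableEq P] {w : P → ℝ} {L L' : Law P}
  {c : P → ℤ} {y : P → ℝ} {i : ℤ}

/-! ### The imbalance of a class -/

/-- The distance of the integer `x` from the interval `[⌊Y⌋, ⌈Y⌉]`. -/
def dev (Y : ℝ) (x : ℤ) : ℤ := max 0 (max (x - ⌈Y⌉) (⌊Y⌋ - x))

theorem dev_nonneg (Y : ℝ) (x : ℤ) : 0 ≤ dev Y x := le_max_left _ _

theorem dev_le_zero_iff {Y : ℝ} {x : ℤ} : dev Y x ≤ 0 ↔ ⌊Y⌋ ≤ x ∧ x ≤ ⌈Y⌉ := by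
  unfold dev
  omega

theorem dev_le_add_abs (Y : ℝ) (x z : ℤ) : dev Y z ≤ dev Y x + |z - x| := by
  have h1 := le_abs_self (z - x)
  have h2 := neg_le_abs (z - x)
  unfold dev
  omega

/-- Moving the count and the interval together preserves the distance. This gives the second of the
two estimates in `imb_reclass_le`. -/
theorem dev_sub_one (Y : ℝ) (x : ℤ) : dev Y (x - 1) = dev (Y + 1) x := by
  unfold dev
  rw [Int.ceil_add_one, Int.floor_add_one]
  omega

/-- The expected distance of the number of pages of class at least `j` from a balanced value. -/
def imb (c : P → ℤ) (y : P → ℝ) (j : ℤ) (L : Law P) : ℝ :=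
  L.ex fun S => (dev (classTotal c y j) (classCount c j S) : ℝ)

theorem balancedAt_iff_imb_nonpos {j : ℤ} : BalancedAt c y j L ↔ imb c y j L ≤ 0 := by
  have hnn : ∀ S, 0 ≤ L.pr S * (dev (classTotal c y j) (classCount c j S) : ℝ) := fun S =>
    mul_nonneg (L.pr_nonneg S) (by exact_mod_cast dev_nonneg _ _)
  constructor
  · intro h
    rw [← L.ex_const 0]
    refine L.ex_mono fun S hS => ?_
    exact_mod_cast dev_le_zero_iff.2 (h S hS)
  · intro h S hS
    have h0 := (Finset.sum_eq_zero_iff_of_nonneg fun S _ => hnn S).1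
      (le_antisymm h (Finset.sum_nonneg fun S _ => hnn S)) S (Finset.mem_univ _)
    rcases mul_eq_zero.1 h0 with h1 | h1
    · exact absurd h1 ((L.pr_ne_zero_iff S).2 hS)
    · exact dev_le_zero_iff.1 (by exact_mod_cast h1.le)

theorem imb_nonneg (c : P → ℤ) (y : P → ℝ) (j : ℤ) (L : Law P) : 0 ≤ imb c y j L := by
  rw [← L.ex_const 0]
  exact L.ex_mono fun S _ => by exact_mod_cast dev_nonneg _ _

/-- A count that is balanced around its mean `Y` is, in expectation, within `|Y' - Y|` of being
balanced around `Y'`. -/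
theorem ex_dev_le_abs {X : Finset P → ℤ} {Y : ℝ} (hX : L.ex (fun S => (X S : ℝ)) = Y)
    (hb : ∀ S, L.mass S ≠ 0 → ⌊Y⌋ ≤ X S ∧ X S ≤ ⌈Y⌉) (Y' : ℝ) :
    L.ex (fun S => (dev Y' (X S) : ℝ)) ≤ |Y' - Y| := by
  -- When the two intervals overlap in at most an endpoint, the distance is an affine function of
  -- the count on the support, so its expectation depends on the mean alone.
  rcases le_or_gt ⌈Y⌉ ⌊Y'⌋ with h | h
  · calc L.ex (fun S => (dev Y' (X S) : ℝ)) ≤ L.ex (fun S => (⌊Y'⌋ : ℝ) - X S) := by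
          refine L.ex_mono fun S hS => ?_
          have h1 := hb S hS
          have h2 := Int.floor_le_ceil Y'
          have : dev Y' (X S) ≤ ⌊Y'⌋ - X S := by
            unfold dev
            omega
          exact_mod_cast this
      _ = ⌊Y'⌋ - Y := by rw [ex_sub, ex_const, hX]
      _ ≤ Y' - Y := by linarith [Int.floor_le Y']
      _ ≤ _ := le_abs_self _
  rcases le_or_gt ⌈Y'⌉ ⌊Y⌋ with h' | h'
  · calc L.ex (fun S => (dev Y' (X S) : ℝ)) ≤ L.ex (fun S => (X S : ℝ) - ⌈Y'⌉) := by
          refine L.ex_mono fun S hS => ?_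
          have h1 := hb S hS
          have h2 := Int.floor_le_ceil Y'
          have : dev Y' (X S) ≤ X S - ⌈Y'⌉ := by
            unfold dev
            omega
          exact_mod_cast this
      _ = Y - ⌈Y'⌉ := by rw [ex_sub, ex_const, hX]
      _ ≤ -(Y' - Y) := by linarith [Int.le_ceil Y']
      _ ≤ _ := neg_le_abs _
  -- In the remaining case `⌊Y⌋ = ⌊Y'⌋`, and the interval of `Y` is contained in that of `Y'`, so
  -- nothing deviates.
  · calc L.ex (fun S => (dev Y' (X S) : ℝ)) ≤ L.ex (fun _ => 0) := by
          refine L.ex_mono fun S hS => ?_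
          have h1 := hb S hS
          have h2 : ⌊Y'⌋ ≤ ⌊Y⌋ := Int.le_floor.2 (Int.lt_ceil.1 h).le
          have h3 : ⌊Y⌋ ≤ ⌊Y'⌋ := Int.le_floor.2 (Int.lt_ceil.1 h').le
          have h4 := Int.ceil_le_floor_add_one Y
          have : dev Y' (X S) ≤ 0 := by
            unfold dev
            omega
          exact_mod_cast this
      _ = 0 := L.ex_const 0
      _ ≤ _ := abs_nonneg _

theorem classCount_insert (c : P → ℤ) (j : ℤ) {q : P} {S : Finset P} (hq : q ∉ S) :
    classCount c j (insert q S) = classCount c j S + if j ≤ c q then 1 else 0 := by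
  unfold classCount
  rw [Finset.filter_insert]
  split_ifs with h
  · rw [Finset.card_insert_of_notMem (by simp [hq])]
    push_cast
    rfl
  · simp

theorem classCount_erase (c : P → ℤ) (j : ℤ) {q : P} {S : Finset P} (hq : q ∈ S) :
    classCount c j (S.erase q) = classCount c j S - if j ≤ c q then 1 else 0 := by
  have := classCount_insert c j (Finset.notMem_erase q S)
  rw [Finset.insert_erase hq] at this
  omega

/-! ### The effect of a rebalancing step -/

/-- The page `q` of class `i` moves between the anti-caches `S` and `B`, which become `S'` and
`B'`: away from `S` if `S` has too many pages of class at least `i`, and to `S` if it has too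
few. -/
def IsSwap (c : P → ℤ) (Y : ℝ) (i : ℤ) (q : P) (S B S' B' : Finset P) : Prop :=
  c q = i ∧
    ((⌈Y⌉ + 1 ≤ classCount c i S ∧ classCount c i B ≤ ⌈Y⌉ - 1 ∧ q ∈ S ∧ q ∉ B ∧
      S' = S.erase q ∧ B' = insert q B) ∨
     (classCount c i S ≤ ⌊Y⌋ - 1 ∧ ⌊Y⌋ + 1 ≤ classCount c i B ∧ q ∈ B ∧ q ∉ S ∧
      S' = insert q S ∧ B' = B.erase q))

namespace IsSwap

variable {Y : ℝ} {q : P} {S B S' B' : Finset P}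

theorem ne (h : IsSwap c Y i q S B S' B') : B ≠ S := by
  rintro rfl
  have := Int.floor_le_ceil Y
  rcases h.2 with h | h <;> omega

theorem count_of_lt (h : IsSwap c Y i q S B S' B') {j : ℤ} (hj : i < j) :
    classCount c j S' = classCount c j S ∧ classCount c j B' = classCount c j B := by
  obtain ⟨rfl, ⟨-, -, h1, h2, rfl, rfl⟩ | ⟨-, -, h1, h2, rfl, rfl⟩⟩ := h <;>
    simp [classCount_insert _ _ h2, classCount_erase _ _ h1, not_le.2 hj]

theorem abs_count (h : IsSwap c Y i q S B S' B') (j : ℤ) :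
    |classCount c j S' - classCount c j S| ≤ 1 ∧ |classCount c j B' - classCount c j B| ≤ 1 := by
  obtain ⟨rfl, ⟨-, -, h1, h2, rfl, rfl⟩ | ⟨-, -, h1, h2, rfl, rfl⟩⟩ := h <;>
    rw [classCount_insert _ _ h2, classCount_erase _ _ h1] <;>
    split_ifs <;> simp

/-- The state `S` lies strictly outside the interval and moves one step towards it. -/
theorem dev_left (h : IsSwap c Y i q S B S' B') :
    dev Y (classCount c i S') = dev Y (classCount c i S) - 1 := by
  have := Int.floor_le_ceil Y
  have := Int.ceil_le_floor_add_one Y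
  obtain ⟨rfl, ⟨h3, h4, h1, h2, rfl, rfl⟩ | ⟨h3, h4, h1, h2, rfl, rfl⟩⟩ := h
  · rw [classCount_erase _ _ h1, if_pos le_rfl]
    unfold dev
    omega
  · rw [classCount_insert _ _ h2, if_pos le_rfl]
    unfold dev
    omega

/-- The strict margin required of the partner leaves room for one page: a balanced partner stays
balanced, and one on the opposite side improves. -/
theorem dev_right (h : IsSwap c Y i q S B S' B') :
    dev Y (classCount c i B') = max 0 (dev Y (classCount c i B) - 1) := by
  have := Int.floor_le_ceil Y
  have := Int.ceil_le_floor_add_one Y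
  obtain ⟨rfl, ⟨h3, h4, h1, h2, rfl, rfl⟩ | ⟨h3, h4, h1, h2, rfl, rfl⟩⟩ := h
  · rw [classCount_insert _ _ h2, if_pos le_rfl]
    unfold dev
    omega
  · rw [classCount_erase _ _ h1, if_pos le_rfl]
    unfold dev
    omega

theorem mem_sum (h : IsSwap c Y i q S B S' B') (r : P) :
    (if r ∈ S' then (1 : ℝ) else 0) - (if r ∈ S then 1 else 0) +
      ((if r ∈ B' then 1 else 0) - (if r ∈ B then 1 else 0)) = 0 := by
  obtain ⟨rfl, ⟨h3, h4, h1, h2, rfl, rfl⟩ | ⟨h3, h4, h1, h2, rfl, rfl⟩⟩ := h <;>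
  · by_cases hr : r = q
    · subst hr
      simp [h1, h2]
    · simp [hr]

/-- One of the two states only fetches the page, which is free; the other evicts it. -/
theorem cost_le (h : IsSwap c Y i q S B S' B') (w : P → ℝ) :
    evictionCost w S S' + evictionCost w B B' ≤ ENNReal.ofReal (w q) := by
  obtain ⟨rfl, ⟨h3, h4, h1, h2, rfl, rfl⟩ | ⟨h3, h4, h1, h2, rfl, rfl⟩⟩ := h <;>
    simp [evictionCost_erase, evictionCost_insert_le]

end IsSwap

/-- Merges the cases of too many and too few pages, so that the later arguments are carried out
once. -/
theorem RebalanceMove.exists_swap (h : RebalanceMove w c y i L L') :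
    ∃ (S : Finset P) (mt : Finset P → ℝ≥0∞) (pg : Finset P → P) (out inn : Finset P → Finset P),
      L.mass S ≠ 0 ∧
      (∀ B, L.mass B ≠ 0 → |(classCount c i B : ℝ) - classTotal c y i| ≤
        |(classCount c i S : ℝ) - classTotal c y i|) ∧
      (∀ B, mt B ≤ L.mass B) ∧ ∑ B, mt B = L.mass S ∧
      (∀ B, mt B ≠ 0 → IsSwap c (classTotal c y i) i (pg B) S B (out B) (inn B)) ∧
      mt S = 0 ∧ Moves w L (swapPlan L S mt out inn) L' := by
  obtain ⟨S, mt, pg, hS, hmax, hmt, hsum, ⟨h1, h2, h3⟩ | ⟨h1, h2, h3⟩⟩ := h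
  · have hsw : ∀ B, mt B ≠ 0 →
        IsSwap c (classTotal c y i) i (pg B) S B (S.erase (pg B)) (insert (pg B) B) := by
      intro B hB
      obtain ⟨h4, h5, h6, h7⟩ := h2 B hB
      exact ⟨h5, Or.inl ⟨h1, h4, h6, h7, rfl, rfl⟩⟩
    exact ⟨S, mt, pg, _, _, hS, hmax, hmt, hsum, hsw,
      by_contra fun h => (hsw S h).ne rfl, h3⟩
  · have hsw : ∀ B, mt B ≠ 0 →
        IsSwap c (classTotal c y i) i (pg B) S B (insert (pg B) S) (B.erase (pg B)) := by
      intro B hB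
      obtain ⟨h4, h5, h6, h7⟩ := h2 B hB
      exact ⟨h5, Or.inr ⟨h1, h4, h6, h7, rfl, rfl⟩⟩
    exact ⟨S, mt, pg, _, _, hS, hmax, hmt, hsum, hsw,
      by_contra fun h => (hsw S h).ne rfl, h3⟩

/-- A rebalancing of class `i` that moves the total probability `a`: it repairs at least `a` of the
imbalance of class `i`, and adds at most `2 a` to that of each lower class. -/
structure Rebalances (w : P → ℝ) (c : P → ℤ) (y : P → ℝ) (i : ℤ) (L L' : Law P) (a : ℝ) :
    Prop where
  nonneg : 0 ≤ a
  ex_mem : ∀ r, L'.ex (fun S => if r ∈ S then 1 else 0) = L.ex (fun S => if r ∈ S then 1 else 0)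
  imb_gt : ∀ j, i < j → imb c y j L' = imb c y j L
  imb_self : imb c y i L' + a ≤ imb c y i L
  imb_le : ∀ j, imb c y j L' ≤ imb c y j L + 2 * a
  cost_le : ∀ W : ℝ, (∀ p, c p = i → w p ≤ W) →
    L'.expectedCost ≤ L.expectedCost + ENNReal.ofReal (a * W)

/-- The amount `a` is the matched measure, which is the mass of `S`. Per unit of it, class `i` gains
one on the side of `S` and loses nothing on the side of the partner, while in any class each of the
two counts changes by at most one. -/
theorem RebalanceMove.rebalances (h : RebalanceMove w c y i L L') :
    ∃ a, Rebalances w c y i L L' a := by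
  obtain ⟨S, mt, pg, out, inn, hS, -, hmt, hsum, hsw, hmS, hm⟩ := h.exists_swap
  have hfin : ∀ S, mt S ≠ ⊤ := fun S => ne_top_of_le_ne_top (L.mass_ne_top S) (hmt S)
  have hex := hm.ex_swap hmt hsum hmS
  have hsw' : ∀ B, (mt B).toReal ≠ 0 →
      IsSwap c (classTotal c y i) i (pg B) S B (out B) (inn B) := fun B hB =>
    hsw B fun h0 => hB (by simp [h0])
  have bound : ∀ (f : Finset P → ℝ) (r : ℝ), (∀ B, (mt B).toReal ≠ 0 →
      f (out B) - f S + (f (inn B) - f B) ≤ r) →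
      L'.ex f ≤ L.ex f + (∑ B, (mt B).toReal) * r := by
    intro f r hf
    rw [hex, Finset.sum_mul]
    gcongr L.ex f + ?_
    refine Finset.sum_le_sum fun B _ => ?_
    by_cases hB : (mt B).toReal = 0
    · simp [hB]
    · exact mul_le_mul_of_nonneg_left (hf B hB) ENNReal.toReal_nonneg
  have exact0 : ∀ (f : Finset P → ℝ), (∀ B, (mt B).toReal ≠ 0 →
      f (out B) - f S + (f (inn B) - f B) = 0) → L'.ex f = L.ex f := by
    intro f hf
    rw [hex, Finset.sum_eq_zero, add_zero]
    intro B _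
    by_cases hB : (mt B).toReal = 0
    · simp [hB]
    · rw [hf B hB, mul_zero]
  refine ⟨∑ B, (mt B).toReal, Finset.sum_nonneg fun _ _ => ENNReal.toReal_nonneg,
    fun r => exact0 _ fun B hB => (hsw' B hB).mem_sum r, fun j hj => exact0 _ fun B hB => ?_,
    ?_, fun j => ?_, fun W hW => ?_⟩
  · obtain ⟨h1, h2⟩ := (hsw' B hB).count_of_lt hj
    simp [h1, h2]
  · have := bound (fun S => (dev (classTotal c y i) (classCount c i S) : ℝ)) (-1) fun B hB => by
      have h1 := (hsw' B hB).dev_left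
      have h2 := (hsw' B hB).dev_right
      have h3 := dev_nonneg (classTotal c y i) (classCount c i B)
      have h4 : dev (classTotal c y i) (classCount c i (out B)) -
          dev (classTotal c y i) (classCount c i S) +
          (dev (classTotal c y i) (classCount c i (inn B)) -
          dev (classTotal c y i) (classCount c i B)) ≤ -1 := by omega
      exact_mod_cast h4
    unfold imb
    linarith
  · have := bound (fun S => (dev (classTotal c y j) (classCount c j S) : ℝ)) 2 fun B hB => by
      obtain ⟨h1, h2⟩ := (hsw' B hB).abs_count j
      have h3 := dev_le_add_abs (classTotal c y j) (classCount c j S) (classCount c j (out B))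
      have h4 := dev_le_add_abs (classTotal c y j) (classCount c j B) (classCount c j (inn B))
      have h5 : dev (classTotal c y j) (classCount c j (out B)) -
          dev (classTotal c y j) (classCount c j S) +
          (dev (classTotal c y j) (classCount c j (inn B)) -
          dev (classTotal c y j) (classCount c j B)) ≤ 2 := by omega
      exact_mod_cast h5
    unfold imb
    linarith
  · refine hm.expectedCost_swap_le.trans ?_
    gcongr
    rw [ENNReal.ofReal_mul (Finset.sum_nonneg fun _ _ => ENNReal.toReal_nonneg),
      ENNReal.ofReal_sum_of_nonneg (fun _ _ => ENNReal.toReal_nonneg), Finset.sum_mul]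
    refine Finset.sum_le_sum fun B _ => ?_
    rw [ENNReal.ofReal_toReal (hfin B)]
    by_cases hB : mt B = 0
    · simp [hB]
    · gcongr
      exact ((hsw B hB).cost_le w).trans (ENNReal.ofReal_le_ofReal (hW _ (hsw B hB).1))

theorem Rebalances.refl (w : P → ℝ) (c : P → ℤ) (y : P → ℝ) (i : ℤ) (L : Law P) :
    Rebalances w c y i L L 0 :=
  ⟨le_rfl, fun _ => rfl, fun _ _ => rfl, by simp, by simp, by simp⟩

theorem Rebalances.trans {M : Law P} {a b : ℝ} (h : Rebalances w c y i L M a)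
    (h' : Rebalances w c y i M L' b) : Rebalances w c y i L L' (a + b) where
  nonneg := add_nonneg h.nonneg h'.nonneg
  ex_mem r := (h'.ex_mem r).trans (h.ex_mem r)
  imb_gt j hj := (h'.imb_gt j hj).trans (h.imb_gt j hj)
  imb_self := by linarith [h.imb_self, h'.imb_self]
  imb_le j := by linarith [h.imb_le j, h'.imb_le j]
  cost_le W hW := by
    rcases le_total 0 W with h0 | h0
    · rw [add_mul, ENNReal.ofReal_add (mul_nonneg h.nonneg h0) (mul_nonneg h'.nonneg h0),
        ← add_assoc]
      exact (h'.cost_le W hW).trans (by gcongr; exact h.cost_le W hW)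
    · have h1 := h.cost_le W hW
      have h2 := h'.cost_le W hW
      rw [ENNReal.ofReal_of_nonpos (mul_nonpos_of_nonneg_of_nonpos h.nonneg h0), add_zero] at h1
      rw [ENNReal.ofReal_of_nonpos (mul_nonpos_of_nonneg_of_nonpos h'.nonneg h0), add_zero] at h2
      exact (h2.trans h1).trans le_self_add

theorem exists_rebalances (h : Relation.ReflTransGen (RebalanceMove w c y i) L L') :
    ∃ a, Rebalances w c y i L L' a := by
  induction h with
  | refl => exact ⟨0, .refl w c y i L⟩
  | tail _ h2 ih =>
    obtain ⟨a, ha⟩ := ih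
    obtain ⟨b, hb⟩ := h2.rebalances
    exact ⟨a + b, ha.trans hb⟩

/-! ### The effect of rebalancing all classes -/

theorem RebalanceList.ex_mem {l : List ℤ} (h : RebalanceList w c y l L L') (r : P) :
    L'.ex (fun S => if r ∈ S then 1 else 0) = L.ex (fun S => if r ∈ S then 1 else 0) := by
  induction l generalizing L with
  | nil => rw [show L' = L from h]
  | cons i l ih =>
    obtain ⟨M, h1, -, h2⟩ := h
    obtain ⟨a, ha⟩ := exists_rebalances h1
    exact (ih h2).trans (ha.ex_mem r)

/-- The cost of rebalancing when the imbalance of the classes up to `i` is at most `d`, and the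
higher classes are balanced. -/
theorem RebalanceList.expectedCost_le {l : List ℤ} {d : ℝ} (hl : l.Pairwise (fun a b => b < a))
    (hw : ∀ p, w p ≤ (6 : ℝ) ^ (c p + 1)) (hd : 0 ≤ d)
    (h0 : ∀ j ∈ l, i < j → imb c y j L ≤ 0) (h1 : ∀ j ∈ l, imb c y j L ≤ d)
    (h : RebalanceList w c y l L L') :
    L'.expectedCost ≤ L.expectedCost + ENNReal.ofReal (12 * (6 : ℝ) ^ i * d) := by
  induction l generalizing L d i with
  | nil =>
    rw [show L' = L from h]
    exact le_self_add
  | cons m l ih =>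
    obtain ⟨M, hM, hb, h2⟩ := h
    obtain ⟨a, ha⟩ := exists_rebalances hM
    have hlt : ∀ j ∈ l, j < m := (List.pairwise_cons.1 hl).1
    have hl' := (List.pairwise_cons.1 hl).2
    have hc := ha.cost_le ((6 : ℝ) ^ (m + 1)) fun p hp => hp ▸ hw p
    have hself := ha.imb_self
    have hnn := imb_nonneg c y m M
    rcases lt_or_ge i m with him | him
    -- Class `m` lies above `i` and is balanced, so no measure moves and the bounds pass on
    -- unchanged.
    · have h3 := h0 m (by simp) him
      have ha0 : a = 0 := le_antisymm (by linarith) ha.nonneg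
      subst ha0
      rw [zero_mul, ENNReal.ofReal_zero, add_zero] at hc
      refine (ih hl' hd (fun j hj hij => ?_) (fun j hj => ?_) h2).trans (by gcongr)
      · exact (ha.imb_le j).trans (by simpa using h0 j (by simp [hj]) hij)
      · exact (ha.imb_le j).trans (by simpa using h1 j (by simp [hj]))
    -- The moved measure is at most `d`, so the imbalance left for lower classes is at most `d + 2 d
    -- = 3 d`. The constant `12` is the fixed point of the recursion: `6 * 6 ^ m * d` for this class
    -- plus `12 * 6 ^ (m - 1) * 3 d` for the rest make `12 * 6 ^ m * d`.
    · have h3 := h1 m (by simp)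
      have had : a ≤ d := by linarith
      have h4 := ih (i := m - 1) (d := 3 * d) hl' (by linarith)
        (fun j hj hij => absurd (hlt j hj) (by omega))
        (fun j hj => (ha.imb_le j).trans (by linarith [h1 j (by simp [hj])])) h2
      refine h4.trans ((add_le_add hc le_rfl).trans ?_)
      rw [add_assoc, ← ENNReal.ofReal_add (mul_nonneg ha.nonneg (by positivity)) (by positivity)]
      gcongr
      have e1 : (6 : ℝ) ^ (m + 1) = 6 ^ m * 6 := zpow_add_one₀ (by norm_num) m
      have e2 : (6 : ℝ) ^ (m - 1) = 6 ^ m / 6 := by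
        rw [zpow_sub_one₀ (by norm_num), div_eq_mul_inv]
      have e3 : (6 : ℝ) ^ m ≤ 6 ^ i := zpow_le_zpow_right₀ (by norm_num) him
      have e4 : (0 : ℝ) < 6 ^ m := by positivity
      rw [e1, e2]
      calc a * ((6 : ℝ) ^ m * 6) + 12 * (6 ^ m / 6) * (3 * d)
          ≤ d * ((6 : ℝ) ^ m * 6) + 12 * (6 ^ m / 6) * (3 * d) := by gcongr
        _ = 12 * 6 ^ m * d := by ring
        _ ≤ 12 * 6 ^ i * d := by gcongr

theorem Rebalance.consistent {z : P → ℝ} (h : Rebalance w c y L L') (hz : ∀ p, 0 ≤ z p)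
    (hL : L.Consistent z) : L'.Consistent z :=
  hL.congr_ex hz fun r => RebalanceList.ex_mem h r

theorem pairwise_sort_gt (s : Finset ℤ) :
    (s.sort (fun a b => b ≤ a)).Pairwise (fun a b => b < a) := by
  have h1 := s.pairwise_sort (fun a b => b ≤ a)
  have h2 := s.sort_nodup (fun a b => b ≤ a)
  exact (h1.and h2).imp fun h => lt_of_le_of_ne h.1 (Ne.symm h.2)

theorem Rebalance.expectedCost_le {d : ℝ} (h : Rebalance w c y L L')
    (hw : ∀ p, w p ≤ (6 : ℝ) ^ (c p + 1)) (hd : 0 ≤ d)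
    (h0 : ∀ j, i < j → imb c y j L ≤ 0) (h1 : ∀ j, j ≤ i → imb c y j L ≤ d) :
    L'.expectedCost ≤ L.expectedCost + ENNReal.ofReal (12 * (6 : ℝ) ^ i * d) :=
  RebalanceList.expectedCost_le (pairwise_sort_gt _) hw hd (fun j _ => h0 j)
    (fun j _ => (le_or_gt j i).elim (h1 j) fun hj => (h0 j hj).trans hd) h

/-! ### Rebalancing balances all classes -/

theorem classTotal_congr {j j' : ℤ} (h : ∀ p, j ≤ c p ↔ j' ≤ c p) :
    classTotal c y j = classTotal c y j' := by
  unfold classTotal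
  simp only [h]

theorem classCount_congr {j j' : ℤ} (h : ∀ p, j ≤ c p ↔ j' ≤ c p) (S : Finset P) :
    classCount c j S = classCount c j' S := by
  unfold classCount
  simp only [h]

theorem BalancedAt.congr {j j' : ℤ} (hb : BalancedAt c y j L) (h : ∀ p, j' ≤ c p ↔ j ≤ c p) :
    BalancedAt c y j' L := by
  intro S hS
  rw [classTotal_congr h, classCount_congr h]
  exact hb S hS

theorem balancedAt_of_lt (h : ∀ p, c p < i) : BalancedAt c y i L := by
  intro S _
  have : ∀ p, ¬ i ≤ c p := fun p => not_le.2 (h p)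
  simp [classTotal, classCount, this]

/-- The list `l` holds the classes that remain to be balanced. -/
structure Remaining (c : P → ℤ) (y : P → ℝ) (l : List ℤ) (L : Law P) : Prop where
  sorted : l.Pairwise (fun a b => b < a)
  mem_or_lt : ∀ p, c p ∈ l ∨ ∀ m ∈ l, m < c p
  balancedAt : ∀ j, (∀ m ∈ l, m < j) → BalancedAt c y j L

theorem Remaining.tail {m : ℤ} {l : List ℤ} {M : Law P} (h : Remaining c y (m :: l) L)
    (hM : Relation.ReflTransGen (RebalanceMove w c y m) L M) (hb : BalancedAt c y m M) :
    Remaining c y l M := by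
  have hlt : ∀ j ∈ l, j < m := (List.pairwise_cons.1 h.sorted).1
  refine ⟨(List.pairwise_cons.1 h.sorted).2, fun p => ?_, fun j hj => ?_⟩
  · rcases h.mem_or_lt p with hp | hp
    · rcases List.mem_cons.1 hp with hp | hp
      · exact Or.inr (hp ▸ hlt)
      · exact Or.inl hp
    · exact Or.inr fun k hk => hp k (by simp [hk])
  · rcases lt_or_ge m j with hmj | hmj
    · obtain ⟨a, ha⟩ := exists_rebalances hM
      rw [balancedAt_iff_imb_nonpos, ha.imb_gt j hmj, ← balancedAt_iff_imb_nonpos]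
      refine h.balancedAt j fun k hk => ?_
      rcases List.mem_cons.1 hk with rfl | hk
      exacts [hmj, hj k hk]
    -- No page has its class in the gap between `j` and `m`, so both thresholds select the same
    -- pages.
    · refine hb.congr fun p => ⟨fun hp => ?_, fun hp => hmj.trans hp⟩
      rcases h.mem_or_lt p with h1 | h1
      · rcases List.mem_cons.1 h1 with h1 | h1
        · exact h1.ge
        · exact absurd (hj _ h1) (not_lt.2 hp)
      · exact (h1 m (by simp)).le

theorem RebalanceList.balanced {l : List ℤ} (h : RebalanceList w c y l L L')
    (hl : Remaining c y l L) : Balanced c y L' := by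
  induction l generalizing L with
  | nil =>
    rw [show L' = L from h]
    exact fun j => hl.balancedAt j (by simp)
  | cons m l ih =>
    obtain ⟨M, hM, hb, h2⟩ := h
    exact ih h2 (hl.tail hM hb)

theorem remaining_sort (c : P → ℤ) (y : P → ℝ) (L : Law P) :
    Remaining c y ((Finset.univ.image c).sort (fun a b => b ≤ a)) L where
  sorted := pairwise_sort_gt _
  mem_or_lt p := Or.inl (by simp)
  balancedAt j hj := balancedAt_of_lt fun p => hj _ (by simp)

theorem Rebalance.balanced (h : Rebalance w c y L L') : Balanced c y L' :=
  RebalanceList.balanced h (remaining_sort c y L)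

/-! ### Rebalancing is possible -/

/-- With `X` the signed deviation of the count from its mean, the positive contribution of `S` has
to be cancelled by states with negative `X`. All of these satisfy `q`, and by maximality each
compensates at most `X S` per unit of mass. -/
theorem mass_le_sum_of_ex_eq_zero {X : Finset P → ℝ} (hX : L.ex X = 0) {S : Finset P}
    (hS : 0 < X S) (q : Finset P → Prop) [DecidablePred q] (hq : ¬ q S)
    (hmax : ∀ B, L.mass B ≠ 0 → |X B| ≤ X S) (hnn : ∀ B, ¬ q B → 0 ≤ X B) :
    L.mass S ≤ ∑ B with q B, L.mass B := by
  -- The integrand is nonnegative on the support: `X B ≥ -X S` if `q B` holds, and otherwise `X B ≥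
  -- 0`, with the last term cancelling exactly at `B = S`.
  have h1 : 0 ≤ L.ex fun B => (X S * (if q B then 1 else 0) + X B) -
      X S * (if B = S then 1 else 0) := by
    refine (L.ex_const 0).ge.trans (L.ex_mono fun B hB => ?_)
    by_cases hqB : q B
    · have hne : B ≠ S := fun h => hq (h ▸ hqB)
      have := neg_abs_le (X B)
      have := hmax B hB
      simp only [hqB, hne, if_true, if_false]
      linarith
    · have := hnn B hqB
      by_cases hBS : B = S
      · simp [hBS, hq]
      · simpa [hqB, hBS] using this
  rw [ex_sub, ex_add, hX] at h1
  have e1 : ∀ f : Finset P → ℝ, L.ex (fun B => X S * f B) = X S * L.ex f := by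
    intro f
    simp only [ex, Finset.mul_sum]
    exact Finset.sum_congr rfl fun B _ => by ring
  rw [e1, e1, add_zero, ← mul_sub] at h1
  have h2 := (mul_nonneg_iff_of_pos_left hS).1 h1
  have e2 : L.ex (fun B => if B = S then 1 else 0) = L.pr S := by simp [ex]
  have e3 : L.ex (fun B => if q B then 1 else 0) = ∑ B with q B, L.pr B := by
    simp [ex, Finset.sum_filter]
  rw [e2, e3] at h2
  simp only [← ofReal_pr]
  rw [← ENNReal.ofReal_sum_of_nonneg fun B _ => L.pr_nonneg B]
  exact ENNReal.ofReal_le_ofReal (by linarith)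

theorem classCount_succ (c : P → ℤ) (j : ℤ) (S : Finset P) :
    classCount c j S = classCount c (j + 1) S + ((S.filter fun p => c p = j).card : ℤ) := by
  unfold classCount
  rw [← Nat.cast_add, ← Finset.card_union_of_disjoint]
  · congr 2
    ext p
    simp only [Finset.mem_filter, Finset.mem_union, ← and_or_left]
    refine and_congr_right fun _ => ?_
    omega
  · refine Finset.disjoint_filter.2 fun p _ h1 h2 => ?_
    omega

/-- A surplus of two in class at least `i`, of which at most one can come from classes above `i`,
forces a surplus of pages of class exactly `i`. -/
theorem exists_page {A B : Finset P} (h : classCount c i B + 2 ≤ classCount c i A)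
    (h' : classCount c (i + 1) A ≤ classCount c (i + 1) B + 1) :
    ∃ p, c p = i ∧ p ∈ A ∧ p ∉ B := by
  by_contra hcon
  push Not at hcon
  have hsub : (A.filter fun p => c p = i) ⊆ B.filter fun p => c p = i := by
    intro p hp
    rw [Finset.mem_filter] at hp ⊢
    exact ⟨hcon p hp.2 hp.1, hp.2⟩
  have := Finset.card_le_card hsub
  rw [classCount_succ c i A, classCount_succ c i B] at h
  omega

/-- Balance of class `i + 1` confines the counts there to a window of width one, as `exists_page`
requires. The partners come from the cancellation of deviations around the mean. -/
theorem Consistent.exists_rebalanceMove (w : P → ℝ) (hc : L.Consistent y) (hy : ∀ p, 0 ≤ y p)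
    (hb : BalancedAt c y (i + 1) L) (hi : ¬ BalancedAt c y i L) :
    ∃ L', RebalanceMove w c y i L L' := by
  set Y := classTotal c y i with hY
  have hmean : L.ex (fun B => (classCount c i B : ℝ) - Y) = 0 := by
    rw [ex_sub, ex_const, hc.ex_classCount hy, sub_self]
  have hmean' : L.ex (fun B => Y - (classCount c i B : ℝ)) = 0 := by
    rw [ex_sub, ex_const, hc.ex_classCount hy, sub_self]
  unfold BalancedAt at hi
  push Not at hi
  obtain ⟨S₀, hS₀, hviol⟩ := hi
  obtain ⟨S, hS, hmax⟩ := Finset.exists_max_image (Finset.univ.filter fun S => L.mass S ≠ 0)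
    (fun B => |(classCount c i B : ℝ) - Y|) ⟨S₀, by simpa using hS₀⟩
  simp only [Finset.mem_filter, Finset.mem_univ, true_and] at hS hmax
  -- A violating integer count is at distance at least `1` from the mean, hence so is the extremal
  -- one. Conversely, distance `1` already implies a violation.
  have habs : 1 ≤ |(classCount c i S : ℝ) - Y| := by
    refine le_trans ?_ (hmax S₀ hS₀)
    rcases lt_or_ge (classCount c i S₀) ⌊Y⌋ with h | h
    · have h1 : (classCount c i S₀ : ℝ) + 1 ≤ ⌊Y⌋ := by exact_mod_cast h
      refine le_trans ?_ (neg_le_abs _)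
      linarith [Int.floor_le Y]
    · have h1 : (⌈Y⌉ : ℝ) + 1 ≤ classCount c i S₀ := by exact_mod_cast hviol h
      refine le_trans ?_ (le_abs_self _)
      linarith [Int.le_ceil Y]
  have hfc := Int.floor_le_ceil (classTotal c y (i + 1))
  have hcf := Int.ceil_le_floor_add_one (classTotal c y (i + 1))
  rcases le_abs.1 habs with h | h
  · have hge : ⌈Y⌉ + 1 ≤ classCount c i S := by
      rw [← Int.ceil_add_one, Int.ceil_le]
      linarith
    have hmass := mass_le_sum_of_ex_eq_zero (S := S) hmean (by linarith)
      (fun B => classCount c i B ≤ ⌈Y⌉ - 1)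
      (by omega) (fun B hB => by rw [← abs_of_pos (a := (classCount c i S : ℝ) - Y) (by linarith)]
                                 exact hmax B hB)
      (fun B hB => by
        have : (⌈Y⌉ : ℝ) ≤ classCount c i B := by exact_mod_cast (by omega)
        linarith [Int.le_ceil Y])
    obtain ⟨mt, hmt, hmt0, hsum⟩ := exists_part hmass
    have hmem : ∀ B, mt B ≠ 0 → classCount c i B ≤ ⌈Y⌉ - 1 := fun B hB => by
      by_contra hcon
      exact hB (hmt0 B (by simpa using hcon))
    have hpg : ∀ B, ∃ p, mt B ≠ 0 → c p = i ∧ p ∈ S ∧ p ∉ B := by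
      intro B
      by_cases hB : mt B = 0
      -- The page is irrelevant where nothing is matched, but the function must be total. An empty
      -- `P` would make count and mean both `0`.
      · have : Nonempty P := by
          by_contra hP
          rw [not_nonempty_iff] at hP
          have h1 : classCount c i S = 0 := by simp [classCount, Finset.eq_empty_of_isEmpty]
          have h2 : Y = 0 := by simp [hY, classTotal]
          rw [h1, h2] at h
          norm_num at h
        exact ⟨Classical.arbitrary P, fun h => absurd hB h⟩
      · have hBL : L.mass B ≠ 0 := fun h => hB (nonpos_iff_eq_zero.1 (h ▸ hmt B))
        have h1 := hb S hS
        have h2 := hb B hBL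
        have h3 := hmem B hB
        obtain ⟨p, hp⟩ := exists_page (c := c) (i := i) (A := S) (B := B) (by omega) (by omega)
        exact ⟨p, fun _ => hp⟩
    choose pg hpg using hpg
    obtain ⟨L', hL'⟩ := exists_moves w (swapPlan_row_sum (out := fun B => S.erase (pg B))
      (inn := fun B => insert (pg B) B) hmt hsum)
    exact ⟨L', S, mt, pg, hS, hmax, hmt, hsum, Or.inl ⟨hge, fun B hB => ⟨hmem B hB, hpg B hB⟩, hL'⟩⟩
  · have hle : classCount c i S ≤ ⌊Y⌋ - 1 := by
      rw [← Int.floor_sub_one, Int.le_floor]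
      linarith
    have hmass := mass_le_sum_of_ex_eq_zero (S := S) hmean' (by linarith)
      (fun B => ⌊Y⌋ + 1 ≤ classCount c i B)
      (by omega) (fun B hB => by rw [← abs_of_pos (a := Y - (classCount c i S : ℝ)) (by linarith),
                                   abs_sub_comm, abs_sub_comm Y]
                                 exact hmax B hB)
      (fun B hB => by
        have : (classCount c i B : ℝ) ≤ ⌊Y⌋ := by exact_mod_cast (by omega)
        linarith [Int.floor_le Y])
    obtain ⟨mt, hmt, hmt0, hsum⟩ := exists_part hmass
    have hmem : ∀ B, mt B ≠ 0 → ⌊Y⌋ + 1 ≤ classCount c i B := fun B hB => by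
      by_contra hcon
      exact hB (hmt0 B (by simpa using hcon))
    have hpg : ∀ B, ∃ p, mt B ≠ 0 → c p = i ∧ p ∈ B ∧ p ∉ S := by
      intro B
      by_cases hB : mt B = 0
      · have : Nonempty P := by
          by_contra hP
          rw [not_nonempty_iff] at hP
          have h1 : classCount c i S = 0 := by simp [classCount, Finset.eq_empty_of_isEmpty]
          have h2 : Y = 0 := by simp [hY, classTotal]
          rw [h1, h2] at h
          norm_num at h
        exact ⟨Classical.arbitrary P, fun h => absurd hB h⟩
      · have hBL : L.mass B ≠ 0 := fun h => hB (nonpos_iff_eq_zero.1 (h ▸ hmt B))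
        have h1 := hb S hS
        have h2 := hb B hBL
        have h3 := hmem B hB
        obtain ⟨p, hp⟩ := exists_page (c := c) (i := i) (A := B) (B := S) (by omega) (by omega)
        exact ⟨p, fun _ => hp⟩
    choose pg hpg using hpg
    obtain ⟨L', hL'⟩ := exists_moves w (swapPlan_row_sum (out := fun B => insert (pg B) S)
      (inn := fun B => B.erase (pg B)) hmt hsum)
    exact ⟨L', S, mt, pg, hS, hmax, hmt, hsum, Or.inr ⟨hle, fun B hB => ⟨hmem B hB, hpg B hB⟩, hL'⟩⟩

/-! ### Rebalancing terminates -/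

/-- The procedure picks `S` by its distance to `Y`, whereas termination needs its distance to the
interval. The two orders agree for swap partners, since these lie on opposite sides and the counts
are integers. -/
theorem IsSwap.dev_le {q : P} {S B S' B' : Finset P} {Y : ℝ} (h : IsSwap c Y i q S B S' B')
    (hmax : |(classCount c i B : ℝ) - Y| ≤ |(classCount c i S : ℝ) - Y|) :
    dev Y (classCount c i B) ≤ dev Y (classCount c i S) := by
  have hf := Int.floor_le Y
  have hc := Int.le_ceil Y
  have hf' := Int.lt_floor_add_one Y
  have hc' := Int.ceil_lt_add_one Y
  have hfc := Int.floor_le_ceil Y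
  obtain ⟨-, ⟨h1, h2, -⟩ | ⟨h1, h2, -⟩⟩ := h
  · have h1' : (⌈Y⌉ : ℝ) + 1 ≤ classCount c i S := by exact_mod_cast h1
    have h2' : (classCount c i B : ℝ) ≤ ⌈Y⌉ - 1 := by exact_mod_cast h2
    rw [abs_of_nonneg (a := (classCount c i S : ℝ) - Y) (by linarith),
      abs_of_nonpos (by linarith)] at hmax
    -- Maximality says that the two counts sum to at least `2 Y`, while `⌊Y⌋ + ⌈Y⌉ < 2 Y + 1`;
    -- integrality removes the slack.
    have : ⌊Y⌋ + ⌈Y⌉ < classCount c i S + classCount c i B + 1 := by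
      have : (⌊Y⌋ : ℝ) + ⌈Y⌉ < classCount c i S + classCount c i B + 1 := by linarith
      exact_mod_cast this
    unfold dev
    omega
  · have h1' : (classCount c i S : ℝ) ≤ ⌊Y⌋ - 1 := by exact_mod_cast h1
    have h2' : (⌊Y⌋ : ℝ) + 1 ≤ classCount c i B := by exact_mod_cast h2
    rw [abs_of_nonpos (a := (classCount c i S : ℝ) - Y) (by linarith),
      abs_of_nonneg (by linarith)] at hmax
    have : (classCount c i S : ℤ) + classCount c i B < ⌊Y⌋ + ⌈Y⌉ + 1 := by
      have : (classCount c i S : ℝ) + classCount c i B < ⌊Y⌋ + ⌈Y⌉ + 1 := by linarith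
      exact_mod_cast this
    unfold dev
    omega

/-- The whole mass of `S` moves, so `S` survives in no other way than as a less deviating state, and
every state newly reached deviates less than `S`. -/
theorem RebalanceMove.support (h : RebalanceMove w c y i L L') :
    ∃ S, L.mass S ≠ 0 ∧ ∀ T, L'.mass T ≠ 0 → (L.mass T ≠ 0 ∧ T ≠ S) ∨
      dev (classTotal c y i) (classCount c i T) < dev (classTotal c y i) (classCount c i S) := by
  obtain ⟨S, mt, pg, out, inn, hS, hmax, hmt, hsum, hsw, hmS, hm⟩ := h.exists_swap
  refine ⟨S, hS, fun T hT => ?_⟩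
  refine (hm.swap_support hT hmt).imp_right ?_
  rintro ⟨B, hB, hTB⟩
  have h1 := (hsw B hB).dev_left
  have h2 := (hsw B hB).dev_right
  have h3 := (hsw B hB).dev_le (hmax B fun h => hB (nonpos_iff_eq_zero.1 (h ▸ hmt B)))
  have h4 := dev_nonneg (classTotal c y i) (classCount c i (out B))
  rcases hTB with rfl | rfl <;> omega

/-- A measure of the imbalance of class `i` that decreases with every step of rebalancing. -/
def potential (c : P → ℤ) (y : P → ℝ) (i : ℤ) (L : Law P) : ℕ :=
  ∑ S with L.mass S ≠ 0,
    (Fintype.card (Finset P) + 1) ^ (dev (classTotal c y i) (classCount c i S)).toNat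

theorem RebalanceMove.potential_lt (h : RebalanceMove w c y i L L') :
    potential c y i L' < potential c y i L := by
  obtain ⟨S, hS, hsupp⟩ := h.support
  unfold potential
  set K := Fintype.card (Finset P) + 1 with hK
  set e : Finset P → ℕ := fun T => (dev (classTotal c y i) (classCount c i T)).toNat with he
  have hSmem : S ∈ Finset.univ.filter fun T => L.mass T ≠ 0 := by simpa using hS
  rw [← Finset.add_sum_erase _ _ hSmem]
  have hsub : (Finset.univ.filter fun T => L'.mass T ≠ 0) ⊆
      (Finset.univ.filter fun T => e T < e S) ∪
        (Finset.univ.filter fun T => L.mass T ≠ 0).erase S := by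
    intro T hT
    simp only [Finset.mem_filter, Finset.mem_univ, true_and, Finset.mem_union,
      Finset.mem_erase] at hT ⊢
    rcases hsupp T hT with h1 | h1
    · exact Or.inr ⟨h1.2, h1.1⟩
    · have := dev_nonneg (classTotal c y i) (classCount c i T)
      left
      simp only [he]
      omega
  -- The base `K` exceeds the number of states, so all less deviating states together weigh less
  -- than `S` alone.
  have hsmall : ∑ T with e T < e S, K ^ e T < K ^ e S := by
    have h1 : (∑ T with e T < e S, K ^ e T) * K ≤ Fintype.card (Finset P) * K ^ e S := by
      rw [Finset.sum_mul]
      calc ∑ T with e T < e S, K ^ e T * K ≤ ∑ T with e T < e S, K ^ e S := by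
            refine Finset.sum_le_sum fun T hT => ?_
            rw [← pow_succ]
            exact Nat.pow_le_pow_right (by omega) (by simpa using hT)
        _ ≤ _ := by
            rw [Finset.sum_const, smul_eq_mul]
            exact Nat.mul_le_mul_right _ (Finset.card_le_univ _)
    have h2 : Fintype.card (Finset P) * K ^ e S < K * K ^ e S :=
      Nat.mul_lt_mul_of_pos_right (by omega) (by positivity)
    have h3 := h1.trans_lt h2
    rw [mul_comm K] at h3
    exact Nat.lt_of_mul_lt_mul_right h3
  calc ∑ T with L'.mass T ≠ 0, K ^ e T ≤ _ := Finset.sum_le_sum_of_subset hsub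
    _ ≤ ∑ T with e T < e S, K ^ e T +
        ∑ T ∈ (Finset.univ.filter fun T => L.mass T ≠ 0).erase S, K ^ e T := by
      rw [← Finset.sum_union_inter]
      exact Nat.le_add_right _ _
    _ < _ := Nat.add_lt_add_right hsmall _

theorem Consistent.exists_balancedAt (w : P → ℝ) (hc : L.Consistent y) (hy : ∀ p, 0 ≤ y p)
    (hb : BalancedAt c y (i + 1) L) :
    ∃ M, Relation.ReflTransGen (RebalanceMove w c y i) L M ∧ BalancedAt c y i M := by
  induction hn : potential c y i L using Nat.strong_induction_on generalizing L with
  | _ n ih =>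
    by_cases hi : BalancedAt c y i L
    · exact ⟨L, .refl, hi⟩
    · obtain ⟨L', hL'⟩ := hc.exists_rebalanceMove w hy hb hi
      obtain ⟨a, ha⟩ := hL'.rebalances
      obtain ⟨M, hM, hMb⟩ := ih _ (hn ▸ hL'.potential_lt) (hc.congr_ex hy ha.ex_mem)
        (by rwa [balancedAt_iff_imb_nonpos, ha.imb_gt _ (lt_add_one i),
          ← balancedAt_iff_imb_nonpos]) rfl
      exact ⟨M, hM.head hL', hMb⟩

theorem Remaining.exists_rebalanceList (w : P → ℝ) {l : List ℤ} (h : Remaining c y l L)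
    (hc : L.Consistent y) (hy : ∀ p, 0 ≤ y p) : ∃ L', RebalanceList w c y l L L' := by
  induction l generalizing L with
  | nil => exact ⟨L, rfl⟩
  | cons m l ih =>
    obtain ⟨M, hM, hb⟩ := hc.exists_balancedAt (i := m) w hy (h.balancedAt _ fun k hk => by
      rcases List.mem_cons.1 hk with rfl | hk
      · exact lt_add_one k
      · exact ((List.pairwise_cons.1 h.sorted).1 k hk).trans (lt_add_one m))
    obtain ⟨a, ha⟩ := exists_rebalances hM
    obtain ⟨L', hL'⟩ := ih (h.tail hM hb) (hc.congr_ex hy ha.ex_mem)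
    exact ⟨L', M, hM, hb, hL'⟩

theorem Consistent.exists_rebalance (w : P → ℝ) (c : P → ℤ) (hc : L.Consistent y)
    (hy : ∀ p, 0 ≤ y p) : ∃ L', Rebalance w c y L L' :=
  (remaining_sort c y L).exists_rebalanceList w hc hy

/-! ### The imbalance caused by the steps of the algorithm -/

theorem classTotal_eq_sum_ite (c : P → ℤ) (y : P → ℝ) (j : ℤ) :
    classTotal c y j = ∑ q, if j ≤ c q then y q else 0 := Finset.sum_filter _ _

theorem classTotal_update (c : P → ℤ) (y : P → ℝ) (j : ℤ) (p : P) (r : ℝ) :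
    classTotal c (Function.update y p r) j =
      classTotal c y j + if j ≤ c p then r - y p else 0 := by
  have := sum_sub_sum_of_eq_off (f := fun q => if j ≤ c q then Function.update y p r q else 0)
    (g := fun q => if j ≤ c q then y q else 0) p fun q hq => by
      simp [Function.update_of_ne hq]
  rw [← classTotal_eq_sum_ite, ← classTotal_eq_sum_ite] at this
  simp only [Function.update_self] at this
  split_ifs at this ⊢ <;> linarith

theorem dev_insert_sub_le (Y : ℝ) (c : P → ℤ) (j : ℤ) {p : P} {S : Finset P} (hp : p ∉ S) :
    (dev Y (classCount c j (insert p S)) : ℝ) - dev Y (classCount c j S) ≤ 1 := by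
  have : dev Y (classCount c j (insert p S)) - dev Y (classCount c j S) ≤ 1 := by
    rw [classCount_insert _ _ hp]
    have := dev_le_add_abs Y (classCount c j S) (classCount c j S + if j ≤ c p then 1 else 0)
    split_ifs at this ⊢
    · rw [add_sub_cancel_left, abs_one] at this
      omega
    · rw [add_zero]
      omega
  exact_mod_cast this

theorem dev_erase_sub_le (Y : ℝ) (c : P → ℤ) (j : ℤ) (p : P) (S : Finset P) :
    (dev Y (classCount c j (S.erase p)) : ℝ) ≤
      dev Y (classCount c j S) + if p ∈ S then 1 else 0 := by
  split_ifs with hp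
  · have : dev Y (classCount c j (S.erase p)) ≤ dev Y (classCount c j S) + 1 := by
      rw [classCount_erase _ _ hp]
      have := dev_le_add_abs Y (classCount c j S) (classCount c j S - if j ≤ c p then 1 else 0)
      split_ifs at this ⊢
      · rw [sub_sub_cancel_left, abs_neg, abs_one] at this
        omega
      · rw [sub_zero]
        omega
    exact_mod_cast this
  · rw [Finset.erase_eq_of_notMem hp, add_zero]

theorem imb_le_abs (hc : L.Consistent y) (hy : ∀ p, 0 ≤ y p) {j : ℤ} (hb : BalancedAt c y j L)
    (Y' : ℝ) : L.ex (fun S => (dev Y' (classCount c j S) : ℝ)) ≤ |Y' - classTotal c y j| :=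
  ex_dev_le_abs (hc.ex_classCount hy c j) hb Y'

section Evict

variable {p : P} {ε : ℝ}

theorem Evict.consistent (h : Evict w p ε L L') (hε : 0 ≤ ε) (hc : L.Consistent y)
    (hy : ∀ p, 0 ≤ y p) : L'.Consistent (Function.update y p (y p + ε)) := by
  obtain ⟨ν, hν, hp, hsum, hex, -⟩ := h.exists_shift hε
  refine consistent_of_ex fun r => ?_
  rw [hex, hc.ex_mem (hy r)]
  by_cases hr : r = p
  · subst hr
    rw [Function.update_self, ← hsum]
    congr 1
    refine Finset.sum_congr rfl fun S _ => ?_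
    by_cases hS : r ∈ S
    · simp [hp S hS]
    · simp [hS]
  · simp [hr]

theorem Evict.imb_of_lt (h : Evict w p ε L L') (hε : 0 ≤ ε) (hb : Balanced c y L) {j : ℤ}
    (hj : c p < j) : imb c (Function.update y p (y p + ε)) j L' ≤ 0 := by
  obtain ⟨ν, hν, hp, hsum, hex, -⟩ := h.exists_shift hε
  unfold imb
  rw [classTotal_update, if_neg (not_le.2 hj), add_zero, hex, Finset.sum_eq_zero, add_zero]
  · exact balancedAt_iff_imb_nonpos.1 (hb j)
  · intro S _
    by_cases hS : p ∈ S
    · simp [hp S hS]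
    · rw [classCount_insert _ _ hS, if_neg (not_le.2 hj), add_zero, sub_self, mul_zero]

/-- One `ε` comes from the shift of the total `Y_j`, the other from the counts that grow by one on
measure `ε`. -/
theorem Evict.imb_le (h : Evict w p ε L L') (hε : 0 ≤ ε) (hc : L.Consistent y)
    (hy : ∀ p, 0 ≤ y p) (hb : Balanced c y L) {j : ℤ} (hj : j ≤ c p) :
    imb c (Function.update y p (y p + ε)) j L' ≤ 2 * ε := by
  obtain ⟨ν, hν, hp, hsum, hex, -⟩ := h.exists_shift hε
  unfold imb
  rw [classTotal_update, if_pos hj, hex]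
  have h1 := imb_le_abs hc hy (hb j) (classTotal c y j + (y p + ε - y p))
  rw [add_sub_cancel_left, add_sub_cancel_left, abs_of_nonneg hε] at h1
  rw [add_sub_cancel_left, two_mul]
  refine add_le_add h1 ?_
  rw [← hsum]
  refine Finset.sum_le_sum fun S _ => ?_
  by_cases hS : p ∈ S
  · simp [hp S hS]
  · exact mul_le_of_le_one_right (hν S) (dev_insert_sub_le _ _ _ hS)

end Evict

theorem consistent_fetch (w : P → ℝ) (p : P) (hc : L.Consistent y) (hy : ∀ p, 0 ≤ y p) :
    (fetch w p L).Consistent (Function.update y p 0) := by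
  refine consistent_of_ex fun r => ?_
  rw [ex_fetch]
  by_cases hr : r = p
  · subst hr
    simp [ex]
  · simp [hr, hc.ex_mem (hy r)]

theorem imb_fetch_of_lt {p : P} (hb : Balanced c y L) {j : ℤ} (hj : c p < j) :
    imb c (Function.update y p 0) j (fetch w p L) ≤ 0 := by
  unfold imb
  rw [classTotal_update, if_neg (not_le.2 hj), add_zero, ex_fetch]
  refine le_trans (L.ex_mono fun S _ => ?_) (balancedAt_iff_imb_nonpos.1 (hb j))
  by_cases hS : p ∈ S
  · rw [classCount_erase _ _ hS, if_neg (not_le.2 hj), sub_zero]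
  · rw [Finset.erase_eq_of_notMem hS]

/-- One `y p` comes from the drop of the total `Y_j`, the other from the states that lose `p`, whose
measure is `y p` by consistency. -/
theorem imb_fetch_le {p : P} (hc : L.Consistent y) (hy : ∀ p, 0 ≤ y p) (hb : Balanced c y L)
    {j : ℤ} (hj : j ≤ c p) :
    imb c (Function.update y p 0) j (fetch w p L) ≤ 2 * y p := by
  unfold imb
  rw [classTotal_update, if_pos hj, ex_fetch]
  have h1 := imb_le_abs hc hy (hb j) (classTotal c y j + (0 - y p))
  rw [add_sub_cancel_left, zero_sub, abs_neg, abs_of_nonneg (hy p)] at h1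
  refine (L.ex_mono fun S _ => dev_erase_sub_le _ _ _ _ _).trans ?_
  rw [ex_add, hc.ex_mem (hy p), zero_sub]
  linarith

/-- Only thresholds between the new and the old class of `q` notice the change. There the imbalance
is at most `2 y q` and also at most `2 (1 - y q)`, hence at most `1`. -/
theorem imb_reclass_le {c' : P → ℤ} {q : P} (hc : L.Consistent y) (hy : ∀ p, 0 ≤ y p)
    (hb : Balanced c y L) (hne : ∀ r, r ≠ q → c' r = c r) (hq : c' q ≤ c q) (j : ℤ) :
    imb c' y j L ≤ if j ≤ c q then 1 else 0 := by
  by_cases hj : j ≤ c q ∧ c' q < j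
  · rw [if_pos hj.1]
    have hT : ∀ z : P → ℝ, classTotal c' z j = classTotal c z j - z q := by
      intro z
      have := sum_sub_sum_of_eq_off (f := fun r => if j ≤ c' r then z r else 0)
        (g := fun r => if j ≤ c r then z r else 0) q fun r hr => by simp [hne r hr]
      rw [← classTotal_eq_sum_ite, ← classTotal_eq_sum_ite, if_pos hj.1,
        if_neg (not_le.2 hj.2)] at this
      linarith
    have hC : ∀ S, classCount c' j S = classCount c j S - if q ∈ S then 1 else 0 := by
      intro S
      have h1 := classCount_eq_sum c' j S
      have h2 := classCount_eq_sum c j S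
      have h3 := hT fun r => if r ∈ S then 1 else 0
      simp only [classTotal] at h3
      rw [h3, ← h2] at h1
      have : (classCount c' j S : ℝ) = ((classCount c j S - if q ∈ S then 1 else 0 : ℤ) : ℝ) := by
        rw [h1]
        push_cast
        rfl
      exact_mod_cast this
    -- View the removal of `q` as a decrease of the total by `y q` and of the count on the states
    -- containing `q`.
    have hub1 : imb c' y j L ≤ 2 * y q := by
      unfold imb
      rw [hT]
      have h1 := imb_le_abs hc hy (hb j) (classTotal c y j - y q)
      rw [sub_sub_cancel_left, abs_neg, abs_of_nonneg (hy q)] at h1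
      have h2 : L.ex (fun S => (dev (classTotal c y j - y q) (classCount c' j S) : ℝ)) ≤
          L.ex fun S => (dev (classTotal c y j - y q) (classCount c j S) : ℝ) +
            if q ∈ S then 1 else 0 := by
        refine L.ex_mono fun S _ => ?_
        have h3 := dev_le_add_abs (classTotal c y j - y q) (classCount c j S) (classCount c' j S)
        rw [hC S, sub_sub_cancel_left, abs_neg] at h3
        rw [hC S]
        split_ifs at h3 ⊢
        · rw [abs_one] at h3
          exact_mod_cast h3
        · simp
      rw [ex_add, hc.ex_mem (hy q)] at h2
      linarith
    -- Subtract `1` from total and count everywhere, which is harmless, and correct back: the total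
    -- by `1 - y q`, the count on the states without `q`.
    have hub2 : imb c' y j L ≤ 2 * (1 - y q) := by
      unfold imb
      rw [hT]
      have hyq : y q ≤ 1 := by
        rw [← hc.ex_mem (hy q), ← L.ex_const 1]
        refine L.ex_mono fun S _ => ?_
        rw [L.ex_const 1]
        split_ifs <;> norm_num
      have h1 := imb_le_abs hc hy (hb j) (classTotal c y j - y q + 1)
      rw [sub_add, sub_sub_cancel_left, neg_sub, abs_of_nonneg (by linarith), ← sub_add] at h1
      have h2 : L.ex (fun S => (dev (classTotal c y j - y q) (classCount c' j S) : ℝ)) ≤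
          L.ex fun S => (dev (classTotal c y j - y q + 1) (classCount c j S) : ℝ) +
            (1 - if q ∈ S then 1 else 0) := by
        refine L.ex_mono fun S _ => ?_
        have h3 := dev_le_add_abs (classTotal c y j - y q) (classCount c j S - 1)
          (classCount c' j S)
        rw [hC S, dev_sub_one, sub_sub_sub_cancel_left] at h3
        rw [hC S]
        split_ifs at h3 ⊢
        · rw [sub_self, abs_zero, add_zero] at h3
          rw [sub_self, add_zero]
          exact_mod_cast h3
        · simp only [sub_zero, abs_one] at h3 ⊢
          exact_mod_cast h3
      rw [ex_add, ex_sub, ex_const, hc.ex_mem (hy q)] at h2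
      linarith
    linarith
  · have hiff : ∀ r, j ≤ c' r ↔ j ≤ c r := by
      intro r
      by_cases hr : r = q
      · subst hr
        omega
      · rw [hne r hr]
    have : imb c' y j L = imb c y j L := by
      unfold imb classTotal classCount
      simp only [hiff]
    rw [this]
    refine (balancedAt_iff_imb_nonpos.1 (hb j)).trans ?_
    split_ifs <;> norm_num

/-! ### The cost of the steps of the algorithm -/

/-- `u` bounds the weights, and `c` gives the classes of `u`. -/
structure Classes (w u : P → ℝ) (c : P → ℤ) : Prop where
  weight_le : ∀ p, w p ≤ u p
  zpow_le : ∀ p, (6 : ℝ) ^ c p ≤ u p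
  le_zpow : ∀ p, u p ≤ (6 : ℝ) ^ (c p + 1)

theorem Classes.pos {u : P → ℝ} (h : Classes w u c) (p : P) : 0 < u p :=
  lt_of_lt_of_le (by positivity) (h.zpow_le p)

theorem Classes.weight_le_zpow {u : P → ℝ} (h : Classes w u c) (p : P) :
    w p ≤ (6 : ℝ) ^ (c p + 1) := (h.weight_le p).trans (h.le_zpow p)

theorem Rebalance.expectedCost_fetch_le {u : P → ℝ} {p : P} (hu : Classes w u c)
    (hc : L.Consistent y) (hy : ∀ p, 0 ≤ y p) (hb : Balanced c y L)
    (h : Rebalance w c (Function.update y p 0) (fetch w p L) L') :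
    L'.expectedCost ≤ L.expectedCost + ENNReal.ofReal (24 * y p * u p) := by
  refine (h.expectedCost_le (i := c p) (d := 2 * y p) hu.weight_le_zpow (by linarith [hy p])
    (fun j hj => imb_fetch_of_lt hb hj) (fun j hj => imb_fetch_le hc hy hb hj)).trans ?_
  rw [expectedCost_fetch]
  refine add_le_add le_rfl (ENNReal.ofReal_le_ofReal ?_)
  have := hu.zpow_le p
  have := hy p
  calc 12 * (6 : ℝ) ^ c p * (2 * y p) = 24 * y p * 6 ^ c p := by ring
    _ ≤ _ := by gcongr

theorem Rebalance.expectedCost_reclass_le {c' : P → ℤ} {r : ℝ} {q : P}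
    (hw : ∀ p, w p ≤ (6 : ℝ) ^ (c' p + 1)) (hr : (6 : ℝ) ^ c q ≤ r)
    (hc : L.Consistent y) (hy : ∀ p, 0 ≤ y p) (hb : Balanced c y L)
    (hne : ∀ r, r ≠ q → c' r = c r) (hq : c' q ≤ c q) (h : Rebalance w c' y L L') :
    L'.expectedCost ≤ L.expectedCost + ENNReal.ofReal (12 * r) := by
  have hi := imb_reclass_le hc hy hb hne hq
  refine (h.expectedCost_le (i := c q) (d := 1) hw zero_le_one
    (fun j hj => by simpa [not_le.2 hj] using hi j)
    (fun j hj => by simpa [hj] using hi j)).trans ?_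
  refine add_le_add le_rfl (ENNReal.ofReal_le_ofReal ?_)
  linarith

theorem Rebalance.expectedCost_le_of_balanced (h : Rebalance w c y L L')
    (hw : ∀ p, w p ≤ (6 : ℝ) ^ (c p + 1)) (hb : Balanced c y L) :
    L'.expectedCost ≤ L.expectedCost := by
  have := h.expectedCost_le (i := 0) (d := 0) hw le_rfl
    (fun j _ => balancedAt_iff_imb_nonpos.1 (hb j))
    (fun j _ => balancedAt_iff_imb_nonpos.1 (hb j))
  simpa using this

theorem EvictPage.consistent {z : P → ℝ} {a b : (P → ℝ) × Law P} (h : EvictPage w c z a b)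
    (hc : a.2.Consistent a.1) (hy : ∀ p, 0 ≤ a.1 p) :
    b.2.Consistent b.1 ∧ Balanced c b.1 b.2 ∧ ∀ p, 0 ≤ b.1 p := by
  obtain ⟨p, M, hp, hb, hM, hr⟩ := h
  have h0 : ∀ q, 0 ≤ b.1 q := by
    intro q
    rw [hb]
    by_cases hq : q = p
    · subst hq
      rw [Function.update_self]
      exact (hy q).trans hp.le
    · rw [Function.update_of_ne hq]
      exact hy q
  have h1 := hM.consistent (by linarith) hc hy
  rw [add_sub_cancel, ← hb] at h1
  exact ⟨hr.consistent h0 h1, hr.balanced, h0⟩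

theorem EvictPage.expectedCost_le {u z : P → ℝ} {a b : (P → ℝ) × Law P}
    (h : EvictPage w c z a b) (hu : Classes w u c)
    (hc : a.2.Consistent a.1) (hb : Balanced c a.1 a.2) (hy : ∀ p, 0 ≤ a.1 p) :
    b.2.expectedCost ≤
      a.2.expectedCost + ENNReal.ofReal (25 * ∑ q, u q * (b.1 q - a.1 q)) ∧
    0 ≤ ∑ q, u q * (b.1 q - a.1 q) := by
  obtain ⟨p, M, hp, hb1, hM, hr⟩ := h
  have hε : 0 ≤ z p - a.1 p := by linarith
  have hsum : ∑ q, u q * (b.1 q - a.1 q) = u p * (z p - a.1 p) := by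
    rw [Finset.sum_eq_single p]
    · rw [hb1, Function.update_self]
    · intro q _ hq
      rw [hb1, Function.update_of_ne hq, sub_self, mul_zero]
    · simp
  have hup := (hu.pos p).le
  rw [hsum]
  refine ⟨?_, mul_nonneg hup hε⟩
  have h1 : ∀ j, c p < j → imb c b.1 j M ≤ 0 := fun j hj => by
    have := hM.imb_of_lt hε hb hj
    rwa [add_sub_cancel, ← hb1] at this
  have h2 : ∀ j, j ≤ c p → imb c b.1 j M ≤ 2 * (z p - a.1 p) := fun j hj => by
    have := hM.imb_le hε hc hy hb hj
    rwa [add_sub_cancel, ← hb1] at this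
  have h3 := hr.expectedCost_le hu.weight_le_zpow (by linarith) h1 h2
  obtain ⟨-, -, -, -, -, h4⟩ := hM.exists_shift hε
  refine h3.trans ((add_le_add h4 le_rfl).trans ?_)
  rw [add_assoc, ← ENNReal.ofReal_mul hε]
  have h5 : ENNReal.ofReal ((z p - a.1 p) * w p) ≤ ENNReal.ofReal ((z p - a.1 p) * u p) := by
    gcongr
    exact hu.weight_le p
  refine add_le_add le_rfl ((add_le_add h5 le_rfl).trans ?_)
  rw [← ENNReal.ofReal_add (mul_nonneg hε hup) (by positivity)]
  gcongr
  have := hu.zpow_le p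
  -- The constant is `25 = 1 + 12 * 2`: the eviction itself, and the rebalancing of an imbalance of
  -- twice the evicted measure.
  calc (z p - a.1 p) * u p + 12 * (6 : ℝ) ^ c p * (2 * (z p - a.1 p))
      ≤ (z p - a.1 p) * u p + 12 * u p * (2 * (z p - a.1 p)) := by gcongr
    _ = 25 * (u p * (z p - a.1 p)) := by ring

theorem reflTransGen_evictPage_consistent {z : P → ℝ} {a b : (P → ℝ) × Law P}
    (h : Relation.ReflTransGen (EvictPage w c z) a b)
    (hc : a.2.Consistent a.1) (hb : Balanced c a.1 a.2) (hy : ∀ p, 0 ≤ a.1 p) :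
    b.2.Consistent b.1 ∧ Balanced c b.1 b.2 ∧ ∀ p, 0 ≤ b.1 p := by
  induction h with
  | refl => exact ⟨hc, hb, hy⟩
  | tail _ h2 ih => exact h2.consistent ih.1 ih.2.2

theorem reflTransGen_evictPage_expectedCost_le {u z : P → ℝ} {a b : (P → ℝ) × Law P}
    (h : Relation.ReflTransGen (EvictPage w c z) a b) (hu : Classes w u c)
    (hc : a.2.Consistent a.1) (hb : Balanced c a.1 a.2) (hy : ∀ p, 0 ≤ a.1 p) :
    b.2.expectedCost ≤
      a.2.expectedCost + ENNReal.ofReal (25 * ∑ q, u q * (b.1 q - a.1 q)) ∧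
    0 ≤ ∑ q, u q * (b.1 q - a.1 q) := by
  induction h with
  | refl => simp
  | @tail b d h1 h2 ih =>
    obtain ⟨hc', hb', hy'⟩ := reflTransGen_evictPage_consistent h1 hc hb hy
    obtain ⟨h3, h4⟩ := h2.expectedCost_le hu hc' hb' hy'
    have e : ∑ q, u q * (d.1 q - a.1 q) =
        ∑ q, u q * (b.1 q - a.1 q) + ∑ q, u q * (d.1 q - b.1 q) := by
      rw [← Finset.sum_add_distrib]
      exact Finset.sum_congr rfl fun q _ => by ring
    rw [e]
    refine ⟨h3.trans ?_, add_nonneg ih.2 h4⟩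
    rw [mul_add, ENNReal.ofReal_add (by linarith [ih.2]) (by linarith), ← add_assoc]
    exact add_le_add ih.1 le_rfl

/-- Each page jumps to its target at once, so the number of pages below target drops. -/
theorem Consistent.exists_followEviction (w : P → ℝ) (c : P → ℤ) {z : P → ℝ}
    (hc : L.Consistent y) (hy : ∀ p, 0 ≤ y p) (hyz : ∀ p, y p ≤ z p) (hz : ∀ p, z p ≤ 1) :
    ∃ L', FollowEviction w c y z L L' := by
  induction hn : (Finset.univ.filter fun p => y p < z p).card using Nat.strong_induction_on
    generalizing y L with
  | _ n ih =>
    by_cases hex : ∃ p, y p < z p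
    · obtain ⟨p, hp⟩ := hex
      obtain ⟨M, hM⟩ := exists_evict w hc (ε := z p - y p) (hy p) (by linarith [hz p])
      have hMc := hM.consistent (by linarith) hc hy
      rw [add_sub_cancel] at hMc
      have hy' : ∀ q, 0 ≤ Function.update y p (z p) q := by
        intro q
        by_cases hq : q = p
        · subst hq
          rw [Function.update_self]
          exact (hy q).trans hp.le
        · rw [Function.update_of_ne hq]
          exact hy q
      obtain ⟨N, hN⟩ := hMc.exists_rebalance w c hy'
      obtain ⟨L', hL'⟩ := ih _ (by
        rw [← hn]
        refine Finset.card_lt_card (Finset.ssubset_iff_of_subset ?_ |>.2 ⟨p, by simpa using hp, ?_⟩)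
        · intro q
          by_cases hq : q = p
          · subst hq
            simp
          · simp [Function.update_of_ne hq]
        · simp) (hN.consistent hy' hMc) hy' (fun q => by
          by_cases hq : q = p
          · subst hq
            rw [Function.update_self]
          · rw [Function.update_of_ne hq]
            exact hyz q) rfl
      exact ⟨L', Relation.ReflTransGen.head ⟨p, M, hp, rfl, hM, hN⟩ hL'⟩
    · push Not at hex
      have : y = z := funext fun p => le_antisymm (hyz p) (hex p)
      subst this
      exact ⟨L, .refl⟩

end Law

variable {P : Type*} [Fintype P] [DecidableEq P]

namespace FracState

variable {st : FracState P}

/-! ### The confidence bounds -/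

theorem observe_of_ne (n T : ℕ) {p r : P} (v : ℝ) (hr : r ≠ p) :
    (st.observe n T p v).cnt r = st.cnt r ∧ (st.observe n T p v).wbar r = st.wbar r ∧
      (st.observe n T p v).lcb r = st.lcb r ∧ (st.observe n T p v).ucb r = st.ucb r := by
  simp [observe, hr]

theorem observe_cnt_self (n T : ℕ) (p : P) (v : ℝ) :
    (st.observe n T p v).cnt p = st.cnt p + 1 := by
  simp [observe]

theorem observe_wbar_pos (n T : ℕ) {p : P} {v : ℝ} (hv : 0 < v)
    (hw : 1 ≤ st.cnt p → 0 < st.wbar p) : 0 < (st.observe n T p v).wbar p := by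
  simp only [observe, Function.update_self]
  split_ifs with h
  · exact hv
  · have := hw (Nat.one_le_iff_ne_zero.2 h)
    push_cast
    rw [add_sub_cancel_right]
    positivity

theorem observe_lcb_pos {n T : ℕ} (hn : 0 < n) (hT : 0 < T) {p : P} {v : ℝ} (hv : 0 < v)
    (hl : 1 ≤ st.cnt p → 0 < st.lcb p) : 0 < (st.observe n T p v).lcb p := by
  have hn' : (0 : ℝ) < n := by exact_mod_cast hn
  have hT' : (0 : ℝ) < T := by exact_mod_cast hT
  simp only [observe, Function.update_self]
  split_ifs with h
  · positivity
  · exact lt_max_of_lt_left (hl (Nat.one_le_iff_ne_zero.2 h))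

theorem observe_ucb_pos (n T : ℕ) {p : P} {v : ℝ} (hv : 0 < v) (hu : 0 < st.ucb p)
    (hw : 1 ≤ st.cnt p → 0 < st.wbar p) : 0 < (st.observe n T p v).ucb p := by
  have h1 := observe_wbar_pos n T hv hw
  simp only [observe, Function.update_self] at h1 ⊢
  split_ifs with h
  · exact one_pos
  · rw [if_neg h] at h1
    exact lt_min hu (add_pos_of_pos_of_nonneg h1 (Real.sqrt_nonneg _))

theorem observe_ucb_le (n T : ℕ) {p : P} (v : ℝ) (hu : st.cnt p = 0 → st.ucb p = 1) :
    (st.observe n T p v).ucb p ≤ st.ucb p := by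
  simp only [observe, Function.update_self]
  split_ifs with h
  · exact (hu h).ge
  · exact min_le_left _ _

theorem observe_ucb_of_cnt_eq_zero (n T : ℕ) {p : P} (v : ℝ) (h : st.cnt p = 0) :
    (st.observe n T p v).ucb p = 1 := by
  simp [observe, h]

theorem classes {w : P → ℝ} (hu : ∀ p, 0 < st.ucb p) (hb : st.BoundsValid w) :
    Law.Classes w st.ucb st.cls where
  weight_le p := (hb p).2
  zpow_le p := Int.zpow_log_le_self (by norm_num) (hu p)
  le_zpow p := (Int.lt_zpow_succ_log_self (by norm_num) _).le

/-! ### The continuous eviction -/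

theorem le_flowY {k : ℕ} {p q : P} {s : ℝ} (hs : 0 ≤ s) (hy : 0 ≤ st.y q)
    (hl : q ≠ p → st.y q < 1 → 0 < st.lcb q) : st.y q ≤ flowY k st p s q := by
  unfold flowY
  split_ifs with h
  · have h1 : 1 ≤ Real.exp (s / st.lcb q) := Real.one_le_exp (div_nonneg hs (hl h.1 h.2).le)
    have h2 : 0 ≤ st.y q + 1 / (k : ℝ) := by positivity
    refine le_min h.2.le ?_
    nlinarith
  · exact le_rfl

theorem flowY_le_one {k : ℕ} {p q : P} {s : ℝ} (hy : st.y q ≤ 1) : flowY k st p s q ≤ 1 := by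
  unfold flowY
  split_ifs
  · exact min_le_left _ _
  · exact hy

theorem flowY_self (k : ℕ) (p : P) (s : ℝ) : flowY k st p s p = st.y p := by
  simp [flowY]

theorem continuous_flowY (k : ℕ) (p q : P) : Continuous fun s => flowY k st p s q := by
  unfold flowY
  split_ifs <;> fun_prop

/-- The shift `1 / k` keeps the growth exponential even from `y = 0`. -/
theorem eventually_flowY_eq_one {k : ℕ} (hk : 0 < k) {p q : P} (hy : 0 ≤ st.y q)
    (hy1 : st.y q ≤ 1) (hqp : q ≠ p) (hl : st.y q < 1 → 0 < st.lcb q) :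
    ∀ᶠ s in Filter.atTop, flowY k st p s q = 1 := by
  unfold flowY
  by_cases h : st.y q < 1
  · have hlim : Filter.Tendsto (fun s : ℝ => (st.y q + 1 / (k : ℝ)) * Real.exp (s / st.lcb q))
        Filter.atTop Filter.atTop :=
      (Real.tendsto_exp_atTop.comp (Filter.tendsto_id.atTop_div_const (hl h))).const_mul_atTop
        (by positivity)
    filter_upwards [hlim.eventually_ge_atTop (1 + 1 / (k : ℝ))] with s hs
    rw [if_pos ⟨hqp, h⟩]
    exact min_eq_left (by linarith)
  · filter_upwards with s
    rw [if_neg fun h' => h h'.2]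
    exact le_antisymm hy1 (not_lt.1 h)

/-- The continuous eviction runs until a sample is demanded or feasibility is reached. -/
theorem exists_canFlow {k : ℕ} (hk : 1 ≤ k) {p : P} (hp : st.y p = 0)
    (hy : ∀ q, 0 ≤ st.y q) (hy1 : ∀ q, st.y q ≤ 1) (hl : ∀ q, q ≠ p → st.y q < 1 → 0 < st.lcb q)
    (hm : ∀ q, 1 ≤ st.cnt q → st.m q ≤ st.cnt q)
    (hdem : ∀ q, ¬ st.Demands q) (hfeas : ¬ st.Feasible k) :
    ∃ s, st.CanFlow k p s ∧
      ((st.flow k p s).Feasible k ∨ ∃ q, (st.flow k p s).Demands q) := by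
  -- The flow must stop when the largest of these continuous functions reaches `0`: `none` stands
  -- for feasibility, `some q` for a demand of `q`. The value `-1` keeps unsampled pages from ever
  -- being the maximum at that time.
  let g : Option P → ℝ → ℝ := fun o s => o.elim
    (∑ q, flowY k st p s q - ((Fintype.card P : ℝ) - k))
    (fun q => if 1 ≤ st.cnt q then st.m q + (flowY k st p s q - st.y q) - st.cnt q else -1)
  have hne : (Finset.univ : Finset (Option P)).Nonempty := ⟨none, Finset.mem_univ _⟩
  let F : ℝ → ℝ := fun s => Finset.univ.sup' hne fun o => g o s
  have hg : ∀ o, Continuous (g o) := by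
    rintro (_ | q)
    · exact (continuous_finsetSum _ fun q _ => continuous_flowY k p q).sub continuous_const
    · have := continuous_flowY (st := st) k p q
      simp only [g, Option.elim]
      split_ifs <;> fun_prop
  have hF : Continuous F := Continuous.finset_sup'_apply hne fun o _ => hg o
  have hF0 : F 0 < 0 := by
    refine (Finset.sup'_lt_iff hne).2 fun o _ => ?_
    rcases o with _ | q
    · simp only [g, Option.elim, flowY_zero]
      unfold Feasible at hfeas
      linarith
    · simp only [g, Option.elim, flowY_zero]
      split_ifs with h
      · have := lt_of_le_of_ne (hm q h) fun h' => hdem q ⟨h, h'⟩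
        linarith
      · norm_num
  obtain ⟨S, hS0, hS⟩ : ∃ S : ℝ, 0 ≤ S ∧ 0 ≤ F S := by
    have h1 : ∀ᶠ s in Filter.atTop, ∀ q, q ≠ p → flowY k st p s q = 1 := by
      refine Filter.eventually_all.2 fun q => ?_
      by_cases hqp : q = p
      · simp [hqp]
      · filter_upwards [eventually_flowY_eq_one hk (hy q) (hy1 q) hqp (hl q hqp)] with s hs _
        exact hs
    obtain ⟨S, hS, hS0⟩ := (h1.and (Filter.eventually_ge_atTop 0)).exists
    refine ⟨S, hS0, le_trans ?_ (Finset.le_sup' _ (Finset.mem_univ none))⟩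
    -- At a late time only the requested page is in the cache, so the sum is `n - 1 ≥ n - k` and the
    -- maximum is nonnegative; the intermediate value theorem applies.
    have h2 : ∑ q, flowY k st p S q = (Fintype.card P : ℝ) - 1 := by
      have := sum_sub_sum_of_eq_off (f := fun q => flowY k st p S q) (g := fun _ => (1 : ℝ)) p hS
      rw [flowY_self, hp, Finset.sum_const, Finset.card_univ, nsmul_eq_mul, mul_one] at this
      linarith
    have h3 : (1 : ℝ) ≤ k := by exact_mod_cast hk
    simp only [g, Option.elim, h2]
    linarith
  obtain ⟨s, hs, hFs⟩ := intermediate_value_Icc hS0 hF.continuousOn ⟨hF0.le, hS⟩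
  have hle : ∀ o, g o s ≤ 0 := fun o => hFs ▸ Finset.le_sup' (fun o => g o s) (Finset.mem_univ o)
  have hspos : 0 < s := by
    refine lt_of_le_of_ne hs.1 ?_
    rintro rfl
    exact hF0.ne hFs
  refine ⟨s, ⟨hspos, hdem, hfeas, fun q hq => ?_, ?_⟩, ?_⟩
  · have := hle (some q)
    simp only [g, Option.elim, if_pos hq] at this
    simp only [flow]
    linarith
  · have := hle none
    simp only [g, Option.elim] at this
    simp only [flow]
    linarith
  · obtain ⟨o, -, ho⟩ := Finset.exists_mem_eq_sup' hne fun o => g o s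
    have ho' : g o s = 0 := ho.symm.trans hFs
    rcases o with _ | q
    · left
      simp only [g, Option.elim] at ho'
      simp only [Feasible, flow]
      linarith
    · right
      simp only [g, Option.elim] at ho'
      split_ifs at ho' with h
      · refine ⟨q, h, ?_⟩
        simp only [flow]
        linarith
      · norm_num at ho'

end FracState

/-! ### The invariant of the randomized algorithm -/

/-- The properties of the configurations that occur in executions. -/
structure Invariant (I : Input P) (c : Config P) : Prop where
  y_nonneg : ∀ q, 0 ≤ c.frac.y q
  y_le_one : ∀ q, c.frac.y q ≤ 1
  ucb_pos : ∀ q, 0 < c.frac.ucb q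
  lcb_pos : ∀ q, 1 ≤ c.frac.cnt q → 0 < c.frac.lcb q
  wbar_pos : ∀ q, 1 ≤ c.frac.cnt q → 0 < c.frac.wbar q
  ucb_eq_one : ∀ q, c.frac.cnt q = 0 → c.frac.ucb q = 1
  m_eq_zero : ∀ q, c.frac.cnt q = 0 → c.frac.m q = 0
  cnt_pos : ∀ q, c.frac.y q < 1 → c.cur ≠ some q → 1 ≤ c.frac.cnt q
  y_cur : ∀ q, c.cur = some q → c.frac.y q = 0
  le_m : ∀ q, 1 ≤ c.frac.cnt q → (c.frac.cnt q : ℝ) - 1 ≤ c.frac.m q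
  m_le : ∀ q, 1 ≤ c.frac.cnt q → c.frac.m q ≤ c.frac.cnt q
  idle : c.cur = none → c.frac.Feasible I.k ∧ ∀ q, ¬ c.frac.Demands q
  -- Positivity of `y q` makes the strict inequality in `unstored` hold after the stored sample is
  -- consumed.
  demands : ∀ q, c.frac.Demands q → (∃ v, c.stored q = some v) ∧ 0 < c.frac.y q
  -- The left side is the value that `m q` would have once `q` is fully evicted. It is constant
  -- under the flow, so `q` cannot cause a demand before its next request.
  unstored : ∀ q, 1 ≤ c.frac.cnt q → c.stored q = none → c.cur ≠ some q →
    c.frac.m q + 1 - c.frac.y q < c.frac.cnt q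
  stored_pos : ∀ q v, c.stored q = some v → 0 < v
  -- The first lower confidence bound has `T` in its denominator and would be `0` for `T = 0`.
  length_pos : c.cur ≠ none → 0 < I.requests.length
  todo_le : c.todo.length ≤ I.requests.length
  consistent : c.law.Consistent c.frac.y
  balanced : c.law.Balanced c.frac.cls c.frac.y

namespace Invariant

variable {I : Input P} {x : P → ℕ → ℝ} {c c' : Config P}

theorem lcb_pos_of_ne (h : Invariant I c) {p q : P} (hcur : c.cur = some p) (hq : q ≠ p)
    (hy : c.frac.y q < 1) : 0 < c.frac.lcb q :=
  h.lcb_pos q (h.cnt_pos q hy (by rw [hcur]; simpa using hq.symm))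

theorem le_flow (h : Invariant I c) {p : P} (hcur : c.cur = some p) {s : ℝ} (hs : 0 ≤ s)
    (q : P) : c.frac.y q ≤ (c.frac.flow I.k p s).y q :=
  FracState.le_flowY hs (h.y_nonneg q) fun hq hy => h.lcb_pos_of_ne hcur hq hy

/-- An unsampled page is either fully evicted or the one being requested, and neither moves. -/
theorem flow_eq (h : Invariant I c) {p : P} (hcur : c.cur = some p) {q : P} (s : ℝ)
    (hq : c.frac.cnt q = 0) : (c.frac.flow I.k p s).y q = c.frac.y q := by
  refine if_neg fun h' => ?_
  have := h.cnt_pos q h'.2 (by rw [hcur]; simpa using h'.1.symm)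
  omega

theorem init (I : Input P) : Invariant I (Config.init I) where
  y_nonneg q := by simp [Config.init, FracState.init]
  y_le_one q := by simp [Config.init, FracState.init]
  ucb_pos q := by simp [Config.init, FracState.init]
  lcb_pos q := by simp [Config.init, FracState.init]
  wbar_pos q := by simp [Config.init, FracState.init]
  ucb_eq_one q := by simp [Config.init, FracState.init]
  m_eq_zero q := by simp [Config.init, FracState.init]
  cnt_pos q := by simp [Config.init, FracState.init]
  y_cur q := by simp [Config.init]
  le_m q := by simp [Config.init, FracState.init]
  m_le q := by simp [Config.init, FracState.init]
  idle _ := by simp [Config.init, FracState.init, FracState.Feasible, FracState.Demands]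
  demands q := by simp [Config.init, FracState.init, FracState.Demands]
  unstored q := by simp [Config.init, FracState.init]
  stored_pos q := by simp [Config.init]
  length_pos := by simp [Config.init]
  todo_le := le_rfl
  consistent := by
    refine Law.consistent_of_ex fun p => ?_
    have : ∀ S, (Config.init I).law.mass S ≠ 0 → (if p ∈ S then (1 : ℝ) else 0) = 1 := by
      intro S hS
      have : S = Finset.univ := by
        by_contra h
        exact hS (by simp [Config.init, Law.mass, PMF.pure_map, PMF.pure_apply, h])
      simp [this]
    rw [Law.ex_congr _ this, Law.ex_const]
    rfl
  balanced := by
    intro j S hS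
    have : S = Finset.univ := by
      by_contra h
      exact hS (by simp [Config.init, Law.mass, PMF.pure_map, PMF.pure_apply, h])
    subst this
    simp [Law.classTotal, Law.classCount, Config.init, FracState.init]

theorem request (h : Invariant I c) {p : P} {l : List P} {L : Law P} (hcur : c.cur = none)
    (htodo : c.todo = p :: l)
    (hL : Law.Rebalance I.weight (c.frac.fetch p).cls (c.frac.fetch p).y
      (c.law.fetch I.weight p) L) :
    Invariant I { c with todo := l, cur := some p, frac := c.frac.fetch p, law := L } := by
  have hy : ∀ q, 0 ≤ (c.frac.fetch p).y q := by
    intro q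
    by_cases hq : q = p
    · subst hq
      simp [FracState.fetch]
    · simpa [FracState.fetch, hq] using h.y_nonneg q
  exact
  { h with
    y_nonneg := hy
    y_le_one := fun q => by
      by_cases hq : q = p
      · subst hq
        simp [FracState.fetch]
      · simpa [FracState.fetch, hq] using h.y_le_one q
    cnt_pos := fun q hq hqp => by
      have hqp : q ≠ p := fun h => hqp (h ▸ rfl)
      refine h.cnt_pos q ?_ (by simp [hcur])
      simpa [FracState.fetch, hqp] using hq
    y_cur := fun q hq => by
      obtain rfl : p = q := Option.some.inj hq
      simp [FracState.fetch]
    idle := fun h => by simp at h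
    demands := fun q hq => absurd hq ((h.idle hcur).2 q)
    unstored := fun q hq hs hqp => by
      have hqp : q ≠ p := fun h => hqp (h ▸ rfl)
      have := h.unstored q hq hs (by simp [hcur])
      simpa [FracState.fetch, hqp] using this
    length_pos := fun _ => by
      have := h.todo_le
      rw [htodo, List.length_cons] at this
      omega
    todo_le := by
      have := h.todo_le
      rw [htodo, List.length_cons] at this
      show l.length ≤ _
      omega
    consistent := hL.consistent hy (Law.consistent_fetch _ p h.consistent h.y_nonneg)
    balanced := hL.balanced }

theorem evict (h : Invariant I c) {p : P} {s : ℝ} {L : Law P} (hcur : c.cur = some p)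
    (hs : c.frac.CanFlow I.k p s)
    (hL : Law.FollowEviction I.weight c.frac.cls c.frac.y (c.frac.flow I.k p s).y c.law L) :
    Invariant I { c with frac := c.frac.flow I.k p s, law := L } := by
  have hle := h.le_flow hcur hs.1.le
  have hm : ∀ q, (c.frac.flow I.k p s).m q =
      c.frac.m q + ((c.frac.flow I.k p s).y q - c.frac.y q) := fun _ => rfl
  have hcons := Law.reflTransGen_evictPage_consistent hL h.consistent h.balanced h.y_nonneg
  exact
  { h with
    y_nonneg := fun q => (h.y_nonneg q).trans (hle q)
    y_le_one := fun q => FracState.flowY_le_one (h.y_le_one q)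
    m_eq_zero := fun q hq => by
      show (c.frac.flow I.k p s).m q = 0
      rw [hm, h.flow_eq hcur s hq, h.m_eq_zero q hq]
      simp
    cnt_pos := fun q hq hqp => h.cnt_pos q ((hle q).trans_lt hq) hqp
    y_cur := fun q hq => by
      obtain rfl : p = q := Option.some.inj (hcur.symm.trans hq)
      exact (FracState.flowY_self _ _ _).trans (h.y_cur p hcur)
    le_m := fun q hq => by
      show _ ≤ (c.frac.flow I.k p s).m q
      have := h.le_m q hq
      rw [hm]
      have := hle q
      exact le_add_of_le_of_nonneg ‹_› (by linarith)
    m_le := hs.2.2.2.1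
    idle := fun h => by simp [hcur] at h
    demands := fun q hq => by
      have h1 : 1 ≤ c.frac.cnt q := hq.1
      have h2 : (c.frac.flow I.k p s).m q = c.frac.cnt q := hq.2
      rw [hm] at h2
      have h3 : c.frac.m q < c.frac.cnt q :=
        lt_of_le_of_ne (h.m_le q h1) fun h' => hs.2.1 q ⟨h1, h'⟩
      -- No demand was pending, so `m q` has strictly increased, and `y q` with it.
      have h4 : 0 < (c.frac.flow I.k p s).y q := by linarith [h.y_nonneg q]
      refine ⟨?_, h4⟩
      by_contra hcon
      have hst : c.stored q = none := by
        cases hv : c.stored q with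
        | none => rfl
        | some v => exact absurd ⟨v, hv⟩ hcon
      have hqp : c.cur ≠ some q := by
        intro hq'
        obtain rfl : p = q := Option.some.inj (hcur.symm.trans hq')
        have h5 : (c.frac.flow I.k p s).y p = c.frac.y p := FracState.flowY_self _ _ _
        linarith
      have h5 := h.unstored q h1 hst hqp
      have h6 : (c.frac.flow I.k p s).y q ≤ 1 := FracState.flowY_le_one (h.y_le_one q)
      linarith
    unstored := fun q hq hst hqp => by
      have := h.unstored q hq hst hqp
      show (c.frac.flow I.k p s).m q + 1 - (c.frac.flow I.k p s).y q < c.frac.cnt q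
      rw [hm]
      linarith
    consistent := hcons.1
    balanced := hcons.2.1 }

/-- Covers both kinds of supply; at a first sample `m q` and the count are both `0`. Afterwards `m
q` is one below the new count, so `q` has no further demand. -/
theorem observe (h : Invariant I c) {p q : P} {v : ℝ} {L : Law P} (hcur : c.cur = some p)
    (hm : c.frac.m q = c.frac.cnt q) (hy : c.cur ≠ some q → 0 < c.frac.y q) (hv : 0 < v)
    (hL : Law.Rebalance I.weight
      (c.frac.observe (Fintype.card P) I.requests.length q v).cls c.frac.y c.law L) :
    Invariant I { c with
      frac := c.frac.observe (Fintype.card P) I.requests.length q v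
      law := L
      stored := Function.update c.stored q none } := by
  set st := c.frac.observe (Fintype.card P) I.requests.length q v with hst
  have hne : ∀ r, r ≠ q → st.cnt r = c.frac.cnt r ∧ st.wbar r = c.frac.wbar r ∧
      st.lcb r = c.frac.lcb r ∧ st.ucb r = c.frac.ucb r := fun r hr =>
    FracState.observe_of_ne _ _ v hr
  have hcnt : st.cnt q = c.frac.cnt q + 1 := FracState.observe_cnt_self _ _ _ _
  have hdem : ∀ r, st.Demands r → r ≠ q ∧ c.frac.Demands r := by
    intro r hr
    have hrq : r ≠ q := by
      rintro rfl
      have h1 : c.frac.m r = st.cnt r := hr.2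
      rw [hcnt, hm] at h1
      push_cast at h1
      linarith
    refine ⟨hrq, ?_, ?_⟩
    · rw [← (hne r hrq).1]
      exact hr.1
    · rw [← (hne r hrq).1]
      exact hr.2
  exact
  { h with
    ucb_pos := fun r => by
      by_cases hr : r = q
      · subst hr
        exact FracState.observe_ucb_pos _ _ hv (h.ucb_pos r) (h.wbar_pos r)
      · exact (hne r hr).2.2.2 ▸ h.ucb_pos r
    lcb_pos := fun r hc => by
      by_cases hr : r = q
      · subst hr
        exact FracState.observe_lcb_pos (Fintype.card_pos_iff.2 ⟨r⟩)
          (h.length_pos (by simp [hcur])) hv (h.lcb_pos r)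
      · exact (hne r hr).2.2.1 ▸ h.lcb_pos r ((hne r hr).1 ▸ hc)
    wbar_pos := fun r hc => by
      by_cases hr : r = q
      · subst hr
        exact FracState.observe_wbar_pos _ _ hv (h.wbar_pos r)
      · exact (hne r hr).2.1 ▸ h.wbar_pos r ((hne r hr).1 ▸ hc)
    ucb_eq_one := fun r hc => by
      have hr : r ≠ q := by
        rintro rfl
        have : st.cnt r = 0 := hc
        omega
      exact (hne r hr).2.2.2 ▸ h.ucb_eq_one r ((hne r hr).1 ▸ hc)
    m_eq_zero := fun r hc => by
      have hr : r ≠ q := by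
        rintro rfl
        have : st.cnt r = 0 := hc
        omega
      exact h.m_eq_zero r ((hne r hr).1 ▸ hc)
    cnt_pos := fun r hr hc => by
      have h1 := h.cnt_pos r hr hc
      show 1 ≤ st.cnt r
      by_cases hrq : r = q
      · subst hrq
        omega
      · rwa [(hne r hrq).1]
    le_m := fun r hc => by
      by_cases hr : r = q
      · subst hr
        show (st.cnt r : ℝ) - 1 ≤ c.frac.m r
        rw [hcnt, hm]
        push_cast
        linarith
      · have := h.le_m r ((hne r hr).1 ▸ hc)
        rwa [← (hne r hr).1] at this
    m_le := fun r hc => by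
      by_cases hr : r = q
      · subst hr
        show c.frac.m r ≤ st.cnt r
        rw [hcnt, hm]
        push_cast
        linarith
      · have := h.m_le r ((hne r hr).1 ▸ hc)
        rwa [← (hne r hr).1] at this
    idle := fun h => by simp [hcur] at h
    demands := fun r hr => by
      obtain ⟨h1, h2⟩ := hdem r hr
      have h3 := h.demands r h2
      exact ⟨by simpa [h1] using h3.1, h3.2⟩
    unstored := fun r hc hs hrc => by
      by_cases hr : r = q
      · subst hr
        show c.frac.m r + 1 - c.frac.y r < st.cnt r
        rw [hcnt, hm]
        push_cast
        linarith [hy hrc]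
      · have := h.unstored r ((hne r hr).1 ▸ hc) (by simpa [hr] using hs) hrc
        rwa [← (hne r hr).1] at this
    stored_pos := fun r u hu => by
      by_cases hr : r = q
      · subst hr
        simp at hu
      · exact h.stored_pos r u (by simpa [hr] using hu)
    consistent := hL.consistent h.y_nonneg h.consistent
    balanced := hL.balanced }

theorem draw (h : Invariant I c) (hx : ∀ p i, x p i ∈ Set.Ioc (0 : ℝ) 1) {p : P}
    (hcur : c.cur = some p) (hdem : ∀ q, ¬ c.frac.Demands q) :
    Invariant I { c with
      law := c.law.evictAndRefetch I.weight p
      stored := Function.update c.stored p (some (x p (c.drawn p)))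
      drawn := Function.update c.drawn p (c.drawn p + 1) } :=
  { h with
    idle := fun h => by simp [hcur] at h
    demands := fun q hq => absurd hq (hdem q)
    unstored := fun q hq hs hqp => by
      have hne : q ≠ p := by
        rintro rfl
        simp at hs
      exact h.unstored q hq (by simpa [hne] using hs) hqp
    stored_pos := fun q v hv => by
      by_cases hq : q = p
      · subst hq
        simp only [Function.update_self, Option.some.injEq] at hv
        exact hv ▸ (hx q _).1
      · exact h.stored_pos q v (by simpa [hq] using hv)
    consistent := fun q => by
      simp only [Law.mass_evictAndRefetch]
      exact h.consistent q
    balanced := fun j S hS => by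
      rw [Law.mass_evictAndRefetch] at hS
      exact h.balanced j S hS }

theorem close (h : Invariant I c) {p : P} {v : ℝ} (hcur : c.cur = some p)
    (hdem : ∀ q, ¬ c.frac.Demands q) (hfeas : c.frac.Feasible I.k) (hcnt : 1 ≤ c.frac.cnt p)
    (hv : c.stored p = some v) : Invariant I { c with cur := none } :=
  { h with
    cnt_pos := fun q hq _ => by
      by_cases hqp : q = p
      · exact hqp ▸ hcnt
      · exact h.cnt_pos q hq (by rw [hcur]; simpa using Ne.symm hqp)
    y_cur := fun q hq => by simp at hq
    idle := fun _ => ⟨hfeas, hdem⟩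
    unstored := fun q hq hs _ => by
      refine h.unstored q hq hs fun hqp => ?_
      obtain rfl : p = q := Option.some.inj (hcur.symm.trans hqp)
      have hs' : c.stored p = none := hs
      simp [hv] at hs'
    length_pos := fun h => absurd rfl h }

theorem step (h : Invariant I c) (hx : ∀ p i, x p i ∈ Set.Ioc (0 : ℝ) 1)
    (hstep : Step I x c c') : Invariant I c' := by
  cases hstep with
  | request p l L hcur htodo hL => exact h.request hcur htodo hL
  | evict p s L hcur hs hL => exact h.evict hcur hs hL
  | supply p q v L hcur hq hv hL =>
    exact h.observe hcur hq.2 (fun _ => (h.demands q hq).2) (h.stored_pos q v hv) hL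
  | draw p hcur hdem hfeas hst => exact h.draw hx hcur hdem
  | supplyFirst p v L hcur hdem hfeas hcnt hv hL =>
    refine h.observe hcur ?_ (fun hne => absurd hcur hne) (h.stored_pos p v hv) hL
    rw [h.m_eq_zero p hcnt, hcnt, Nat.cast_zero]
  | close p v hcur hdem hfeas hcnt hv => exact h.close hcur hdem hfeas hcnt hv

theorem reflTransGen (h : Invariant I c) (hx : ∀ p i, x p i ∈ Set.Ioc (0 : ℝ) 1)
    (hsteps : Relation.ReflTransGen (Step I x) c c') : Invariant I c' := by
  induction hsteps with
  | refl => exact h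
  | tail _ h2 ih => exact ih.step hx h2

/-- Balance at a threshold below all classes concerns the size of the whole anti-cache, and
feasibility bounds its floor from below by `n - k`. -/
theorem compl_card_le (h : Invariant I c) (hcur : c.cur = none) {S : Finset P}
    (hS : c.law.mass S ≠ 0) : Sᶜ.card ≤ I.k := by
  obtain ⟨j, hj⟩ := (Set.finite_range c.frac.cls).bddBelow
  have hj' : ∀ p, j ≤ c.frac.cls p := fun p => hj ⟨p, rfl⟩
  have h1 := (h.balanced j S hS).1
  have h2 := (h.idle hcur).1
  have e1 : Law.classTotal c.frac.cls c.frac.y j = ∑ q, c.frac.y q := by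
    simp [Law.classTotal, hj']
  have e2 : Law.classCount c.frac.cls j S = S.card := by
    simp [Law.classCount, hj']
  rw [e1, e2] at h1
  have h3 : (Fintype.card P : ℤ) - I.k ≤ ⌊∑ q, c.frac.y q⌋ := by
    rw [Int.le_floor]
    push_cast
    exact h2
  have h4 := Finset.card_le_univ S
  rw [Finset.card_compl]
  omega

/-! ### Every partial execution can be continued -/

/-- Once the fractional algorithm is done with a request, the request can be completed. -/
theorem exists_close_of_feasible (h : Invariant I c) (hx : ∀ p i, x p i ∈ Set.Ioc (0 : ℝ) 1)
    {p : P} (hcur : c.cur = some p) (hdem : ∀ q, ¬ c.frac.Demands q)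
    (hfeas : c.frac.Feasible I.k) :
    ∃ c', Relation.ReflTransGen (Step I x) c c' ∧ c'.cur = none ∧ c'.todo = c.todo := by
  have hdone : ∀ c : Config P, c.cur = some p → (∀ q, ¬ c.frac.Demands q) →
      c.frac.Feasible I.k → 1 ≤ c.frac.cnt p →
      ∃ c', Relation.ReflTransGen (Step I x) c c' ∧ c'.cur = none ∧ c'.todo = c.todo := by
    intro c hcur hdem hfeas hcnt
    cases hv : c.stored p with
    | some v => exact ⟨_, .single (.close c p v hcur hdem hfeas hcnt hv), rfl, rfl⟩
    | none =>
      have hst := Step.draw (x := x) c p hcur hdem hfeas hv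
      exact ⟨_, (Relation.ReflTransGen.single hst).tail
        (.close { c with
          law := c.law.evictAndRefetch I.weight p
          stored := Function.update c.stored p (some (x p (c.drawn p)))
          drawn := Function.update c.drawn p (c.drawn p + 1) } p _ hcur hdem hfeas hcnt
          (Function.update_self ..)), rfl, rfl⟩
  have hfirst : ∀ c : Config P, Invariant I c → c.cur = some p → (∀ q, ¬ c.frac.Demands q) →
      c.frac.Feasible I.k → c.frac.cnt p = 0 → (∃ v, c.stored p = some v) →
      ∃ c', Relation.ReflTransGen (Step I x) c c' ∧ c'.cur = none ∧ c'.todo = c.todo := by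
    rintro c h hcur hdem hfeas hcnt ⟨v, hv⟩
    obtain ⟨L, hL⟩ := h.consistent.exists_rebalance I.weight
      (c.frac.observe (Fintype.card P) I.requests.length p v).cls h.y_nonneg
    have hst := Step.supplyFirst (x := x) c p v L hcur hdem hfeas hcnt hv hL
    obtain ⟨c', h1, h2, h3⟩ := hdone { c with
        frac := c.frac.observe (Fintype.card P) I.requests.length p v
        law := L
        stored := Function.update c.stored p none } hcur (fun q hq => by
      by_cases hqp : q = p
      · subst hqp
        have h1 : c.frac.m q =
          (c.frac.observe (Fintype.card P) I.requests.length q v).cnt q := hq.2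
        rw [FracState.observe_cnt_self, hcnt, h.m_eq_zero q hcnt] at h1
        norm_num at h1
      · have hne := (FracState.observe_of_ne (st := c.frac) (Fintype.card P)
          I.requests.length v hqp).1
        refine hdem q ⟨?_, ?_⟩
        · rw [← hne]
          exact hq.1
        · rw [← hne]
          exact hq.2) hfeas
      (by
        show 1 ≤ (c.frac.observe (Fintype.card P) I.requests.length p v).cnt p
        rw [FracState.observe_cnt_self]
        omega)
    exact ⟨c', h1.head hst, h2, h3⟩
  rcases Nat.eq_zero_or_pos (c.frac.cnt p) with hcnt | hcnt
  · cases hv : c.stored p with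
    | some v => exact hfirst c h hcur hdem hfeas hcnt ⟨v, hv⟩
    | none =>
      have hst := Step.draw (x := x) c p hcur hdem hfeas hv
      obtain ⟨c', h1, h2, h3⟩ := hfirst _ (h.step hx hst) (by exact hcur) (by exact hdem)
        (by exact hfeas) (by exact hcnt) ⟨_, Function.update_self ..⟩
      exact ⟨c', h1.head hst, h2, h3⟩
  · exact hdone c hcur hdem hfeas hcnt

theorem exists_close (h : Invariant I c) (hx : ∀ p i, x p i ∈ Set.Ioc (0 : ℝ) 1)
    {p : P} (hcur : c.cur = some p) :
    ∃ c', Relation.ReflTransGen (Step I x) c c' ∧ c'.cur = none ∧ c'.todo = c.todo := by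
  -- Every supply uses up a stored sample and the flow creates none, so the number of stored samples
  -- bounds the number of interruptions of the eviction.
  induction hn : (Finset.univ.filter fun q => c.stored q ≠ none).card
    using Nat.strong_induction_on generalizing c with
  | _ n ih =>
    have hdemand : ∀ c : Config P, Invariant I c → c.cur = some p →
        (Finset.univ.filter fun q => c.stored q ≠ none).card = n →
        (∃ q, c.frac.Demands q) →
        ∃ c', Relation.ReflTransGen (Step I x) c c' ∧ c'.cur = none ∧ c'.todo = c.todo := by
      rintro c h hcur hn ⟨q, hq⟩
      obtain ⟨⟨v, hv⟩, -⟩ := h.demands q hq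
      obtain ⟨L, hL⟩ := h.consistent.exists_rebalance I.weight
        (c.frac.observe (Fintype.card P) I.requests.length q v).cls h.y_nonneg
      have hst := Step.supply (x := x) c p q v L hcur hq hv hL
      obtain ⟨c', h1, h2, h3⟩ := ih _ (by
        rw [← hn]
        refine Finset.card_lt_card (Finset.ssubset_iff_of_subset ?_ |>.2
          ⟨q, by simp [hv], by simp⟩)
        · intro r
          by_cases hr : r = q
          · subst hr
            simp
          · simp [hr]) (h.step hx hst) (by exact hcur) rfl
      exact ⟨c', h1.head hst, h2, h3⟩
    by_cases hdem : ∃ q, c.frac.Demands q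
    · exact hdemand c h hcur hn hdem
    have hdem' : ∀ q, ¬ c.frac.Demands q := fun q hq => hdem ⟨q, hq⟩
    by_cases hfeas : c.frac.Feasible I.k
    · exact h.exists_close_of_feasible hx hcur hdem' hfeas
    obtain ⟨s, hs, hor⟩ := FracState.exists_canFlow I.k_pos (h.y_cur p hcur) h.y_nonneg h.y_le_one
      (fun q hq hy => h.lcb_pos_of_ne hcur hq hy) h.m_le hdem' hfeas
    obtain ⟨L, hL⟩ := h.consistent.exists_followEviction I.weight c.frac.cls h.y_nonneg
      (h.le_flow hcur hs.1.le) fun q => FracState.flowY_le_one (h.y_le_one q)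
    have hst := Step.evict (x := x) c p s L hcur hs hL
    have h' := h.step hx hst
    have : ∃ c', Relation.ReflTransGen (Step I x)
        { c with frac := c.frac.flow I.k p s, law := L } c' ∧ c'.cur = none ∧
          c'.todo = c.todo := by
      by_cases hd : ∃ q, (c.frac.flow I.k p s).Demands q
      · exact hdemand _ h' hcur hn hd
      · exact h'.exists_close_of_feasible hx hcur (fun q hq => hd ⟨q, hq⟩)
          (hor.resolve_right hd)
    obtain ⟨c', h1, h2⟩ := this
    exact ⟨c', h1.head hst, h2⟩

theorem exists_finished (h : Invariant I c) (hx : ∀ p i, x p i ∈ Set.Ioc (0 : ℝ) 1) :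
    ∃ c', Relation.ReflTransGen (Step I x) c c' ∧ c'.Finished := by
  have key : ∀ (n : ℕ) (c : Config P), Invariant I c → c.todo.length = n → c.cur = none →
      ∃ c', Relation.ReflTransGen (Step I x) c c' ∧ c'.Finished := by
    intro n
    induction n with
    | zero =>
      intro c _ hn hcur
      exact ⟨c, .refl, hcur, List.length_eq_zero_iff.1 hn⟩
    | succ n ih =>
      intro c h hn hcur
      obtain ⟨p, l, hl⟩ := List.exists_cons_of_length_eq_add_one hn
      have hc := Law.consistent_fetch I.weight p h.consistent h.y_nonneg
      obtain ⟨L, hL⟩ := hc.exists_rebalance I.weight (c.frac.fetch p).cls fun q => by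
        by_cases hq : q = p
        · subst hq
          simp
        · simpa [hq] using h.y_nonneg q
      have hst := Step.request (x := x) c p l L hcur hl hL
      have h' := h.step hx hst
      obtain ⟨c₁, h1, h2, h3⟩ := h'.exists_close hx rfl
      obtain ⟨c₂, h4, h5⟩ := ih c₁ (h'.reflTransGen hx h1) (by
        rw [h3]
        rw [hl, List.length_cons] at hn
        exact Nat.succ.inj hn) h2
      exact ⟨c₂, (h1.head hst).trans h4, h5⟩
  cases hcur : c.cur with
  | none => exact key _ c h rfl hcur
  | some p =>
    obtain ⟨c₁, h1, h2, -⟩ := h.exists_close hx hcur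
    obtain ⟨c₂, h3, h4⟩ := key _ c₁ (h.reflTransGen hx h1) rfl h2
    exact ⟨c₂, h1.trans h3, h4⟩

end Invariant

/-! ### The cost of the randomized algorithm -/

/-- The number of samples of `p` that will be taken without a further payment. -/
def Config.pending (c : Config P) (p : P) : ℝ :=
  (if c.frac.cnt p = 0 then 1 else 0) + if c.stored p = none then 1 else 0

/-- The part of the payments for `p` that is kept for later costs: for the next fetch of `p`, for
the next change of its class, and for the pending samples. -/
def Config.credit (w : P → ℝ) (c : Config P) (p : P) : ℝ :=
  24 * c.frac.y p * c.frac.ucb p +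
    (if c.frac.cnt p = 0 then 0
      else 13 * (c.frac.m p - ((c.frac.cnt p : ℝ) - 1)) * c.frac.ucb p) +
    w p * c.pending p

namespace Invariant

variable {I : Input P} {x : P → ℕ → ℝ} {c c' : Config P}

theorem credit_nonneg (h : Invariant I c) (hw : ∀ p, 0 ≤ I.weight p) (p : P) :
    0 ≤ c.credit I.weight p := by
  have h1 := h.y_nonneg p
  have h2 := (h.ucb_pos p).le
  have h3 := hw p
  unfold Config.credit Config.pending
  refine add_nonneg (add_nonneg (by positivity) ?_) (mul_nonneg h3 ?_)
  · split_ifs with h0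
    · exact le_rfl
    · have := h.le_m p (Nat.one_le_iff_ne_zero.2 h0)
      exact mul_nonneg (by linarith) h2
  · split_ifs <;> norm_num

theorem classes (h : Invariant I c) (hb : c.frac.BoundsValid I.weight) :
    Law.Classes I.weight c.frac.ucb c.frac.cls :=
  FracState.classes h.ucb_pos hb

/-- The cost of a step is covered by the payments of the fractional algorithm and the change of
the credit. -/
theorem step_cost (h : Invariant I c) (hx : ∀ p i, x p i ∈ Set.Ioc (0 : ℝ) 1)
    (hw : ∀ p, 0 ≤ I.weight p) (hstep : Step I x c c') (hb : c'.frac.BoundsValid I.weight) :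
    ∃ δ : ℝ, 0 ≤ δ ∧ c'.law.expectedCost ≤ c.law.expectedCost + ENNReal.ofReal δ ∧
      δ + (∑ p, c'.credit I.weight p - ∑ p, c.credit I.weight p) ≤
        62 * (c'.frac.cost - c.frac.cost) := by
  have hcl := (h.step hx hstep).classes hb
  cases hstep with
  | request p l L hcur htodo hL =>
    refine ⟨24 * c.frac.y p * c.frac.ucb p, ?_,
      hL.expectedCost_fetch_le hcl h.consistent h.y_nonneg h.balanced, ?_⟩
    · have := h.y_nonneg p
      have := (h.ucb_pos p).le
      positivity
    · have hm : (c.frac.fetch p).m = c.frac.m := rfl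
      have hcnt : (c.frac.fetch p).cnt = c.frac.cnt := rfl
      have hucb : (c.frac.fetch p).ucb = c.frac.ucb := rfl
      have hcost : (c.frac.fetch p).cost = c.frac.cost := rfl
      have hy : (c.frac.fetch p).y = Function.update c.frac.y p 0 := rfl
      rw [sum_sub_sum_of_eq_off p fun q hq => by
        simp only [Config.credit, Config.pending, hm, hcnt, hucb, hy, Function.update_of_ne hq]]
      simp only [Config.credit, Config.pending, hm, hcnt, hucb, hy, hcost, Function.update_self]
      linarith
  | evict p s L hcur hs hL =>
    replace hcl : Law.Classes I.weight c.frac.ucb c.frac.cls := hcl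
    obtain ⟨h1, h2⟩ := Law.reflTransGen_evictPage_expectedCost_le hL hcl h.consistent h.balanced
      h.y_nonneg
    refine ⟨_, mul_nonneg (by norm_num) h2, h1, le_of_eq ?_⟩
    have hcost : (c.frac.flow I.k p s).cost =
        c.frac.cost + ∑ q, c.frac.ucb q * ((c.frac.flow I.k p s).y q - c.frac.y q) := rfl
    -- The credit grows at rate `37 = 24 + 13`, which with the `25` paid for the eviction gives
    -- `62`. For unsampled pages both sides vanish, since they do not move.
    have hcr : ∀ q, Config.credit I.weight { c with frac := c.frac.flow I.k p s, law := L } q -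
        c.credit I.weight q =
        37 * (c.frac.ucb q * ((c.frac.flow I.k p s).y q - c.frac.y q)) := by
      intro q
      have hm : (c.frac.flow I.k p s).m q =
        c.frac.m q + ((c.frac.flow I.k p s).y q - c.frac.y q) := rfl
      have hcnt : (c.frac.flow I.k p s).cnt q = c.frac.cnt q := rfl
      have hucb : (c.frac.flow I.k p s).ucb q = c.frac.ucb q := rfl
      simp only [Config.credit, Config.pending, hm, hcnt, hucb]
      split_ifs with h0
      · rw [h.flow_eq hcur s h0]
        ring
      · rw [h.flow_eq hcur s h0]
        ring
      · ring
      · ring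
    rw [← Finset.sum_sub_distrib, Finset.sum_congr rfl fun q _ => hcr q, ← Finset.mul_sum, hcost]
    ring
  | supply p q v L hcur hq hv hL =>
    set st := c.frac.observe (Fintype.card P) I.requests.length q v with hst
    have hne : ∀ r, r ≠ q → st.cnt r = c.frac.cnt r ∧ st.wbar r = c.frac.wbar r ∧
        st.lcb r = c.frac.lcb r ∧ st.ucb r = c.frac.ucb r := fun r hr =>
      FracState.observe_of_ne _ _ v hr
    have hcnt : st.cnt q = c.frac.cnt q + 1 := FracState.observe_cnt_self _ _ _ _
    have hle : st.ucb q ≤ c.frac.ucb q := FracState.observe_ucb_le _ _ v (h.ucb_eq_one q)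
    have hpos : 0 < st.ucb q := hcl.pos q
    have hup : 0 < c.frac.ucb q := h.ucb_pos q
    -- At a demand `m q` equals the count, so `13` times the old bound is released: `12` parts pay
    -- for the rebalancing, and the last one covers the weight of the replacement sample that
    -- becomes pending.
    refine ⟨12 * c.frac.ucb q, by positivity,
      hL.expectedCost_reclass_le (q := q) hcl.weight_le_zpow
        (Int.zpow_log_le_self (by norm_num) hup) h.consistent h.y_nonneg h.balanced
        (fun r hr => ?_) (Int.log_mono_right hpos hle), ?_⟩
    · show Int.log 6 (st.ucb r) = Int.log 6 (c.frac.ucb r)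
      rw [(hne r hr).2.2.2]
    · rw [sum_sub_sum_of_eq_off q fun r hr => by
        have h1 : st.y r = c.frac.y r := rfl
        have h2 : st.m r = c.frac.m r := rfl
        simp only [Config.credit, Config.pending, (hne r hr).1, (hne r hr).2.2.2, h1, h2,
          Function.update_of_ne hr]]
      have h1 : st.y q = c.frac.y q := rfl
      have h2 : st.m q = c.frac.m q := rfl
      have h3 : st.cost = c.frac.cost := rfl
      have h4 : c.frac.cnt q ≠ 0 := Nat.one_le_iff_ne_zero.1 hq.1
      simp only [Config.credit, Config.pending, h1, h2, h3, hcnt, hv, if_neg h4, hq.2,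
        Function.update_self, if_true, reduceCtorEq, if_false]
      push_cast
      have h6 : I.weight q ≤ st.ucb q := hcl.weight_le q
      have h7 := mul_le_mul_of_nonneg_left hle (h.y_nonneg q)
      linarith
  | draw p hcur hdem hfeas hst =>
    refine ⟨I.weight p, hw p, (Law.expectedCost_evictAndRefetch _ _ _).le, ?_⟩
    rw [sum_sub_sum_of_eq_off p fun q hq => by
      simp [Config.credit, Config.pending, hq]]
    simp only [Config.credit, Config.pending, hst, Function.update_self, if_true, reduceCtorEq,
      if_false]
    linarith
  | supplyFirst p v L hcur hdem hfeas hcnt hv hL =>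
    set st := c.frac.observe (Fintype.card P) I.requests.length p v with hst
    have hne : ∀ r, r ≠ p → st.cnt r = c.frac.cnt r ∧ st.wbar r = c.frac.wbar r ∧
        st.lcb r = c.frac.lcb r ∧ st.ucb r = c.frac.ucb r := fun r hr =>
      FracState.observe_of_ne _ _ v hr
    have hcnt' : st.cnt p = c.frac.cnt p + 1 := FracState.observe_cnt_self _ _ _ _
    have hucb : ∀ r, st.ucb r = c.frac.ucb r := by
      intro r
      by_cases hr : r = p
      · subst hr
        rw [h.ucb_eq_one r hcnt]
        exact FracState.observe_ucb_of_cnt_eq_zero _ _ _ hcnt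
      · exact (hne r hr).2.2.2
    have hcls : st.cls = c.frac.cls := funext fun r => by
      unfold FracState.cls
      rw [hucb]
    refine ⟨0, le_rfl, ?_, ?_⟩
    · rw [ENNReal.ofReal_zero, add_zero]
      exact hL.expectedCost_le_of_balanced hcl.weight_le_zpow (by rw [hcls]; exact h.balanced)
    · rw [sum_sub_sum_of_eq_off p fun r hr => by
        have h1 : st.y r = c.frac.y r := rfl
        have h2 : st.m r = c.frac.m r := rfl
        simp only [Config.credit, Config.pending, (hne r hr).1, hucb, h1, h2,
          Function.update_of_ne hr]]
      have h1 : st.y p = c.frac.y p := rfl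
      have h2 : st.m p = c.frac.m p := rfl
      have h3 : st.cost = c.frac.cost := rfl
      -- One pending sample is traded for another: the page is no longer unsampled, but its store is
      -- empty again.
      simp [Config.credit, Config.pending, h1, h2, h3, hcnt', hv, hcnt, hucb, h.m_eq_zero p hcnt]
  | close p v hcur hdem hfeas hcnt hv =>
    exact ⟨0, le_rfl, by simp, by simp [Config.credit, Config.pending]⟩

end Invariant

/-- Sums the amortised costs of the steps. Initially each page has credit `24 + 2 w`, for its first
fetch and for its first two samples, which is at most `26`. -/
theorem ReachableGood.exists_bound {I : Input P} {x : P → ℕ → ℝ}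
    (hx : ∀ p i, x p i ∈ Set.Ioc (0 : ℝ) 1) {c : Config P} (h : ReachableGood I x c) :
    (∀ p, 0 ≤ I.weight p) ∧ Invariant I c ∧ ∃ r : ℝ, 0 ≤ r ∧
      c.law.expectedCost ≤ ENNReal.ofReal r ∧
      r + ∑ p, c.credit I.weight p ≤ 62 * c.frac.cost + 26 * (Fintype.card P : ℝ) := by
  obtain ⟨hb, hsteps⟩ := h
  -- The initial bounds `0` and `1` are part of the good event and already confine the weights.
  have hw : ∀ p, 0 ≤ I.weight p := fun p => (hb p).1
  have hw1 : ∀ p, I.weight p ≤ 1 := fun p => (hb p).2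
  refine ⟨hw, ?_⟩
  induction hsteps with
  | refl =>
    refine ⟨.init I, 0, le_rfl, ?_, ?_⟩
    · simp [Config.init, Law.expectedCost, PMF.pure_apply]
    · calc 0 + ∑ p, (Config.init I).credit I.weight p ≤ ∑ p : P, (26 : ℝ) := by
            rw [zero_add]
            refine Finset.sum_le_sum fun p _ => ?_
            simp only [Config.credit, Config.pending, Config.init, FracState.init, if_true]
            linarith [hw1 p]
        _ = _ := by
            simp [Config.init, FracState.init, mul_comm]
  | tail _ h2 ih =>
    obtain ⟨hinv, r, hr, hcost, hle⟩ := ih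
    obtain ⟨δ, hδ, hcost', hle'⟩ := hinv.step_cost hx hw h2.1 h2.2
    refine ⟨hinv.step hx h2.1, r + δ, add_nonneg hr hδ, ?_, by linarith⟩
    rw [ENNReal.ofReal_add hr hδ]
    exact hcost'.trans (add_le_add hcost le_rfl)

end OWP

end

theorem mainTheorem3 {P : Type*} [Fintype P] [DecidableEq P] (I : OWP.Input P)
    (x : P → ℕ → ℝ) (hx : ∀ p i, x p i ∈ Set.Ioc (0 : ℝ) 1) :
    (∀ c : OWP.Config P, OWP.Reachable I x c →
      c.law.Consistent c.frac.y ∧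
      c.law.Balanced c.frac.cls c.frac.y ∧
      (∀ p, c.cur = some p → ∀ S, c.law.mass S ≠ 0 → p ∉ S) ∧
      (c.cur = none → ∀ S, c.law.mass S ≠ 0 → Sᶜ.card ≤ I.k) ∧
      (∀ q, c.frac.Demands q → ∃ v, c.stored q = some v) ∧
      (∃ c', Relation.ReflTransGen (OWP.Step I x) c c' ∧ c'.Finished)) ∧
    (∀ c : OWP.Config P, OWP.ReachableGood I x c → c.Finished →
      c.law.expectedCost ≤
        ENNReal.ofReal (62 * c.frac.cost + 50 * (Fintype.card P : ℝ))) := by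
  refine ⟨fun c hc => ?_, fun c hc _ => ?_⟩
  · have h := (OWP.Invariant.init I).reflTransGen hx hc
    exact ⟨h.consistent, h.balanced,
      fun p hp S hS => h.consistent.notMem (h.y_cur p hp) hS,
      fun hcur S hS => h.compl_card_le hcur hS, fun q hq => (h.demands q hq).1,
      h.exists_finished hx⟩
  · obtain ⟨hw, h, r, -, hcost, hle⟩ := hc.exists_bound hx
    refine hcost.trans (ENNReal.ofReal_le_ofReal ?_)
    -- The unspent credit is nonnegative and may be dropped; the additive constant `26` obtained
    -- here is below the claimed `50`.
    have h1 := Finset.sum_nonneg fun p (_ : p ∈ Finset.univ) => h.credit_nonneg hw p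
    have h2 : (0 : ℝ) ≤ Fintype.card P := Nat.cast_nonneg _
    linarith
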